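/- Consider one of the following two settings. (a) Polynomial: $\Bbbk$ is a field of characteristic zero, $\Omega^0=\Bbbk[t]$, $\Omega^1=\Bbbk[t]\,dt$, and $s\in\Bbbk$; integrals are evaluated formally, $\int_{0\le t_1\le\cdots\le t_n\le 1}t_1^{l_1-1}\cdots t_n^{l_n-1}\,dt_1\cdots dt_n=\frac{1}{l_1(l_1+l_2)\cdots(l_1+\cdots+l_n)}$ for integers $l_i\ge 1$. (b) Smooth: $\Bbbk=\mathbb R$, $\Omega^0=C^\infty([0,1])$, $\Omega^1=C^\infty([0,1])\,dt$, and $s\in[0,1]$. Let $\Omega^*=\Omega^0\oplus\Omega^1$ and let $C^*=\{b(1-t)+at\}\oplus\{c\,dt\}$ $(a,b,c\in\Bbbk)$ be the space of Whitney forms. Let $\mathbf s$ denote suspension of graded vector spaces. A morphism of reduced tensor coalgebras $F:\overline T(\mathbf sV)\to\overline T(\mathbf sW)$ is given by its Taylor coefficients $F_n:(\mathbf sV)^{\otimes n}\to\mathbf sW$, $n\ge1$, and composition is $(G\circ F)_n=\sum_{i_1+\cdots+i_m=n}G_m\circ(F_{i_1}\otimes\cdots\otimes F_{i_m})$. Let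 $B_k$ and $B_k(t)$ be the Bernoulli numbers and polynomials, with $\frac{z}{e^z-1}=\sum_{k\ge0}B_k\frac{z^k}{k!}$. Define the following morphisms. * $\mu$ (from $C^*$ to $\Omega^*$): $\mu_1$ is the inclusion, $\mu$ is unital, and for $N\ge1$ the coefficient $\mu_{N+1}$ vanishes unless precisely one argument is a function, with $$\mu_{N+1}\big((\mathbf s dt)^{\otimes i}\otimes\mathbf s t\otimes(\mathbf s dt)^{\otimes N-i}\big)=\mathbf s\Big((-1)^i\binom Ni\frac{B_{N+1}(t)-B_{N+1}}{(N+1)!}\Big).$$ * $\lambda$ (from $\Omega^*$ to $C^*$): $\lambda_1(\mathbf s f)=\mathbf s\big(f(1)t+f(0)(1-t)\big)$ for $f\in\Omega^0$; for $n>1$, $\lambda_n$ vanishes if some argument is a zero-form; and for $n\ge1$ $$\lambda_n(\mathbf s a_1dt\otimes\cdots\otimes\mathbf s a_ndt)=\Big(\int_{0\le t_1\le\cdots\le t_n\le1}a_1(t_1)\cdots a_n(t_n)\,dt_1\cdots dt_n\Big)\mathbf s dt.$$ * $\exp=\lambda\circ\mu$ (which has linear part the identity, hence is invertible), $\log=\exp^{-1}$,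 $\varphi=\log\circ\lambda$, and $\varphi_s=\varphi\circ\beta_s^*$, where $\beta_s^*$ is the pullback of forms along $\beta_s(t)=st$, that is $f(t)\mapsto f(st)$ and $a(t)dt\mapsto s\,a(st)dt$. Define $\mathcal M_n:(\Omega^0)^{\otimes n}\to\Omega^0$ by $\mathcal M_1(a_1)(s)=\int_0^sa_1(\tau)\,d\tau$ and, for $n\ge2$, $$\mathcal M_n(a_1\otimes\cdots\otimes a_n)(s)=\sum_{k=1}^{n-1}\frac{B_k}{k!}\sum_{j=0}^k(-1)^j\binom kj\sum_{\substack{i_1+\cdots+i_k=n-1\\ i_h\ge1}}\int_0^s\mathcal M_{i_1}(\cdots)(\tau)\cdots\mathcal M_{i_j}(\cdots)(\tau)\,a_{p_j+1}(\tau)\,\mathcal M_{i_{j+1}}(\cdots)(\tau)\cdots\mathcal M_{i_k}(\cdots)(\tau)\,d\tau,$$ where $p_j=i_1+\cdots+i_j$ and the dots are filled with the arguments other than $a_{p_j+1}$, in their order. **Theorem.** In both settings, for all $n\ge1$, all $a_1,\dots,a_n\in\Omega^0$ and all $s$ as above, $$\varphi_{s,n}(\mathbf s a_1(t)dt\otimes\cdots\otimes\mathbf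 s a_n(t)dt)=\mathcal M_n(a_1(t)\otimes\cdots\otimes a_n(t))(s)\;\mathbf s dt.$$ -/

import Mathlib

open Set MeasureTheory Polynomial
open scoped ContDiff

universe u

noncomputable section

/-! ### Taylor coefficients of morphisms of tensor coalgebras

A morphism of reduced tensor coalgebras `T̄(V) → T̄(W)` (for instance an `A_∞` morphism) is
determined by its Taylor coefficients `F_n : V^{⊗ n} → W`, `n ≥ 1`. We work with these coefficients;
the coefficient with index `0` carries no information and is `0` in all examples below.
For forms and cochains, the graded vector space that occurs is the suspension; as a vector space it
is the same space, so that `𝐬` is not written. Taylor coefficients of morphisms have degree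
zero, so that no signs occur when they are composed. -/

/-- A sequence of Taylor coefficients `F_n : V^{⊗ n} → W`. -/
abbrev TaylorMaps (k V W : Type*) [CommRing k] [AddCommGroup V] [Module k V] [AddCommGroup W]
    [Module k W] : Type _ :=
  (n : ℕ) → MultilinearMap k (fun _ : Fin n => V) W

namespace TaylorMaps

variable {k U V W Z : Type*} [CommRing k] [AddCommGroup U] [Module k U] [AddCommGroup V]
  [Module k V] [AddCommGroup W] [Module k W] [AddCommGroup Z] [Module k Z]

/-- Cut `v` into the consecutive blocks given by `c = (i₁, …, i_m)`, and apply the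
coefficient `f_{i_h}` to the `h`-th block. -/
def applyBlocks (f : TaylorMaps k U V) {n : ℕ} (c : Composition n) (v : Fin n → U) :
    Fin c.length → V :=
  fun h => f (c.blocksFun h) (v ∘ c.embedding h)

theorem applyBlocks_update (f : TaylorMaps k U V) {n : ℕ} (c : Composition n) (j : Fin n)
    (v : Fin n → U) (z : U) :
    f.applyBlocks c (Function.update v j z) =
      Function.update (f.applyBlocks c v) (c.index j)
        (f (c.blocksFun (c.index j))
          (Function.update (v ∘ c.embedding (c.index j)) (c.invEmbedding j) z)) := by
  ext h
  by_cases hh : h = c.index j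
  · rw [hh]
    let r : Fin (c.blocksFun (c.index j)) → Fin n := c.embedding (c.index j)
    simp only [Function.update_self]
    change f (c.blocksFun (c.index j)) (Function.update v j z ∘ r) = _
    let j' := c.invEmbedding j
    suffices B : Function.update v j z ∘ r = Function.update (v ∘ r) j' z by rw [B]
    suffices C : Function.update v (r j') z ∘ r = Function.update (v ∘ r) j' z by
      convert! C; exact (c.embedding_comp_inv j).symm
    exact Function.update_comp_eq_of_injective _ (c.embedding _).injective _ _
  · simp only [hh, Function.update_of_ne, Ne, not_false_iff]
    let r : Fin (c.blocksFun h) → Fin n := c.embedding h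
    change f (c.blocksFun h) (Function.update v j z ∘ r) = f (c.blocksFun h) (v ∘ r)
    suffices B : Function.update v j z ∘ r = v ∘ r by rw [B]
    apply Function.update_comp_eq_of_notMem_range
    rwa [c.mem_range_embedding_iff']

/-- `g_m ∘ (f_{i₁} ⊗ ⋯ ⊗ f_{i_m})` for `c = (i₁, …, i_m)`. -/
def compAlong {n : ℕ} (c : Composition n) (g : MultilinearMap k (fun _ : Fin c.length => V) W)
    (f : TaylorMaps k U V) : MultilinearMap k (fun _ : Fin n => U) W :=
  MultilinearMap.mk' (fun v => g (f.applyBlocks c v))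
    (fun v i x y => by simp only [applyBlocks_update, MultilinearMap.map_update_add])
    (fun v i r x => by simp only [applyBlocks_update, MultilinearMap.map_update_smul])

/-- The Taylor coefficients of the composition of two morphisms of tensor coalgebras:
`(g ∘ f)_n = ∑_{i₁ + ⋯ + i_m = n} g_m ∘ (f_{i₁} ⊗ ⋯ ⊗ f_{i_m})`. -/
def comp (g : TaylorMaps k V W) (f : TaylorMaps k U V) : TaylorMaps k U W :=
  fun n => ∑ c : Composition n, compAlong c (g c.length) f

/-- The strict morphism with a given linear part: all higher Taylor coefficients vanish. -/
def strict (f : U →ₗ[k] V) : TaylorMaps k U V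
  | 0 => 0
  | 1 => LinearMap.compMultilinearMap f (MultilinearMap.ofSubsingleton k U U 0 LinearMap.id)
  | _ + 2 => 0

/-- The identity morphism. -/
def one (k V : Type*) [CommRing k] [AddCommGroup V] [Module k V] : TaylorMaps k V V :=
  strict LinearMap.id

/-- The inverse of a morphism `f` whose linear part is the identity. It is obtained by solving
`(inverse f) ∘ f = id` degree by degree, see `inverse_comp` and `comp_inverse`. -/
def inverse (f : TaylorMaps k V V) : TaylorMaps k V V
  | 0 => 0
  | 1 => one k V 1
  | n + 2 => -∑ c : { c : Composition (n + 2) // c.length < n + 2 },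
      compAlong c.1 (inverse f c.1.length) f

theorem comp_apply (g : TaylorMaps k V W) (f : TaylorMaps k U V) (n : ℕ) (v : Fin n → U) :
    g.comp f n v = ∑ c : Composition n, g c.length (f.applyBlocks c v) := by
  simp [comp, compAlong]

theorem congr_coeff (f : TaylorMaps k U V) {m n : ℕ} {v : Fin m → U} {w : Fin n → U} (h1 : m = n)
    (h2 : ∀ (i : ℕ) (him : i < m) (hin : i < n), v ⟨i, him⟩ = w ⟨i, hin⟩) : f m v = f n w := by
  subst h1
  congr with ⟨i, hi⟩
  exact h2 i hi hi

theorem one_apply_one (v : Fin 1 → V) : one k V 1 v = v 0 := rfl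

theorem one_apply_one' {n : ℕ} (h : n = 1) (v : Fin n → V) :
    one k V n v = v ⟨0, h ▸ Nat.zero_lt_one⟩ := by
  subst h
  rfl

theorem one_apply_of_lt {n : ℕ} (h : 1 < n) (v : Fin n → V) : one k V n v = 0 := by
  match n, h with
  | _ + 2, _ => rfl

theorem applyBlocks_ones (f : TaylorMaps k U V) (n : ℕ) (v : Fin n → U) :
    f.applyBlocks (Composition.ones n) v =
      fun i => f 1 fun _ => v (Fin.castLE (Composition.length_le _) i) := by
  funext i
  apply f.congr_coeff (Composition.ones_blocksFun _ _)
  intro j hjn hj1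
  obtain rfl : j = 0 := by lia
  refine congr_arg v ?_
  rw [Fin.ext_iff, Fin.val_castLE, Composition.ones_embedding, Fin.val_mk]

theorem comp_assoc (r : TaylorMaps k W Z) (q : TaylorMaps k V W) (p : TaylorMaps k U V) :
    (r.comp q).comp p = r.comp (q.comp p) := by
  funext n
  ext v
  let f : (Σ a : Composition n, Composition a.length) → Z := fun c =>
    r c.2.length (applyBlocks q c.2 (applyBlocks p c.1 v))
  let g : (Σ c : Composition n, ∀ i : Fin c.length, Composition (c.blocksFun i)) → Z := fun c =>
    r c.1.length fun i : Fin c.1.length =>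
      q (c.2 i).length (applyBlocks p (c.2 i) (v ∘ c.1.embedding i))
  suffices ∑ c, f c = ∑ c, g c by
    have hl : ((r.comp q).comp p) n v = ∑ c, f c := by
      rw [comp_apply, Fintype.sum_sigma]
      exact Finset.sum_congr rfl fun a _ => comp_apply r q a.length _
    have hr : (r.comp (q.comp p)) n v = ∑ c, g c := by
      rw [comp_apply, Fintype.sum_sigma]
      refine Finset.sum_congr rfl fun a _ => ?_
      have : (q.comp p).applyBlocks a v = fun i => ∑ b : Composition (a.blocksFun i),
          q b.length (p.applyBlocks b (v ∘ a.embedding i)) :=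
        funext fun i => comp_apply q p _ _
      rw [this, MultilinearMap.map_sum]
    rw [hl, hr, this]
  rw [← (Composition.sigmaEquivSigmaPi n).sum_comp]
  apply Finset.sum_congr rfl
  rintro ⟨a, b⟩ _
  dsimp [Composition.sigmaEquivSigmaPi]
  apply r.congr_coeff (Composition.length_gather a b).symm
  intro i hi1 hi2
  apply q.congr_coeff (Composition.length_sigmaCompositionAux a b _).symm
  intro j hj1 hj2
  apply p.congr_coeff (Composition.blocksFun_sigmaCompositionAux a b _ _).symm
  intro l hl1 hl2
  refine congr_arg v (Fin.ext ?_)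
  simp only [Composition.coe_embedding]
  rw [← add_assoc, ← Composition.sizeUpTo_sizeUpTo_add _ _ hi1 hj1]

theorem comp_one (p : TaylorMaps k U V) : p.comp (one k U) = p := by
  funext n
  ext v
  rw [comp_apply, Finset.sum_eq_single (Composition.ones n)]
  · apply p.congr_coeff (Composition.ones_length n)
    intros
    simp only [applyBlocks_ones, one_apply_one]
    refine congr_arg v ?_
    rw [Fin.ext_iff, Fin.val_castLE, Fin.val_mk]
  · intro b _ hb
    obtain ⟨l, hl, lt_l⟩ : ∃ (l : ℕ), l ∈ Composition.blocks b ∧ 1 < l :=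
      Composition.ne_ones_iff.1 hb
    obtain ⟨i, hi⟩ : ∃ (i : Fin b.blocks.length), b.blocks[i] = l :=
      List.get_of_mem hl
    let j : Fin b.length := ⟨i.val, b.blocks_length ▸ i.prop⟩
    have A : 1 < b.blocksFun j := by convert! lt_l
    exact MultilinearMap.map_coord_zero _ j (one_apply_of_lt A _)
  · simp

theorem one_comp (p : TaylorMaps k U V) (h0 : p 0 = 0) : (one k V).comp p = p := by
  funext n
  ext v
  obtain rfl | n_pos := n.eq_zero_or_pos
  · rw [comp_apply, h0]
    refine Finset.sum_eq_zero fun c _ => ?_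
    have hc : c.length = 0 := Nat.le_zero.1 c.length_le
    rw [(one k V).congr_coeff (w := Fin.elim0) hc (fun i _ hi => absurd hi (Nat.not_lt_zero i))]
    rfl
  · rw [comp_apply, Finset.sum_eq_single (Composition.single n n_pos)]
    · rw [one_apply_one' (Composition.single_length n_pos)]
      refine p.congr_coeff rfl fun i him hin => congr_arg v <| ?_
      rw [Fin.ext_iff, Composition.coe_embedding]
      simp
    · intro b _ hb
      have A : 1 < b.length := by
        have : b.length ≠ 1 := by simpa [Composition.eq_single_iff_length] using hb
        have : 0 < b.length := Composition.length_pos_of_pos b n_pos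
        lia
      exact one_apply_of_lt A _
    · simp

theorem inverse_comp (f : TaylorMaps k V V) (h : f 1 = one k V 1) :
    (inverse f).comp f = one k V := by
  funext n
  ext v
  rw [comp_apply]
  have ones_term : inverse f (Composition.ones n).length
      (f.applyBlocks (Composition.ones n) v) = inverse f n v := by
    apply (inverse f).congr_coeff (Composition.ones_length n)
    intros
    simp only [applyBlocks_ones, h, one_apply_one]
    refine congr_arg v ?_
    rw [Fin.ext_iff, Fin.val_castLE, Fin.val_mk]
  have len_ne : ∀ c : Composition n, c ≠ Composition.ones n ↔ c.length < n := fun c => by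
    rw [Ne, Composition.eq_ones_iff_le_length, not_le]
  rw [← Finset.add_sum_erase _ _ (Finset.mem_univ (Composition.ones n)), ones_term]
  have rest : ∑ c ∈ Finset.univ.erase (Composition.ones n),
        inverse f c.length (f.applyBlocks c v) =
      ∑ c : { c : Composition n // c.length < n },
        inverse f c.1.length (f.applyBlocks c.1 v) := by
    refine (Finset.sum_subtype _ (fun c => ?_)
      (fun c : Composition n => inverse f c.length (f.applyBlocks c v)))
    rw [Finset.mem_erase, len_ne]
    simp
  rw [rest]
  match n with
  | 0 =>
    have : IsEmpty { c : Composition 0 // c.length < 0 } := ⟨fun c => Nat.not_lt_zero _ c.2⟩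
    simp [inverse, one, strict]
  | 1 =>
    have : IsEmpty { c : Composition 1 // c.length < 1 } :=
      ⟨fun c => absurd c.2 (not_lt.2 (Composition.length_pos_of_pos c.1 Nat.one_pos))⟩
    simp [inverse]
  | n + 2 =>
    rw [inverse, one_apply_of_lt (by lia)]
    simp [compAlong]

theorem comp_inverse (f : TaylorMaps k V V) (h0 : f 0 = 0) (h : f 1 = one k V 1) :
    f.comp (inverse f) = one k V := by
  have h1 : inverse f 1 = one k V 1 := by rw [inverse]
  have A : (inverse (inverse f)).comp (inverse f) = one k V := inverse_comp _ h1
  have B : inverse (inverse f) = f := by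
    rw [← comp_one (inverse (inverse f)), ← inverse_comp f h, ← comp_assoc, A, one_comp f h0]
  rwa [B] at A

end TaylorMaps

/-! ### Forms and Whitney forms on the interval -/

/-- The operations on an algebra `A` of functions on `[0,1]` from which the morphisms below are
built. Only the two instances `polyIntervalFunctions` and `smoothIntervalFunctions` are used. -/
structure IntervalFunctions (k A : Type*) [Field k] [CommRing A] [Algebra k A] where
  /-- polynomials, as functions on the interval -/
  ofPoly : k[X] →ₗ[k] A
  /-- `f ↦ f(0)` -/
  evalZero : A →ₗ[k] k
  /-- `f ↦ f(1)` -/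
  evalOne : A →ₗ[k] k
  /-- `f ↦ (s ↦ ∫_0^s f(t) dt)` -/
  primitive : A →ₗ[k] A
  /-- `a₁ ⊗ ⋯ ⊗ a_n ↦ ∫_{0 ≤ t₁ ≤ ⋯ ≤ t_n ≤ 1} a₁(t₁) ⋯ a_n(t_n) dt₁ ⋯ dt_n` -/
  simplexIntegral : (n : ℕ) → MultilinearMap k (fun _ : Fin n => A) k

/-- The forms `Ω^* = Ω⁰ ⊕ Ω¹` for an algebra `A` of functions:
the pair `(f, a)` stands for `f(t) + a(t) dt`. -/
abbrev Forms (A : Type*) : Type _ := A × A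

/-- The Whitney forms (or simplicial cochains) `C^* = C⁰ ⊕ C¹` on `[0,1]`:
`((b, a), c)` stands for `b (1 - t) + a t + c dt`. -/
abbrev Whitney (k : Type*) : Type _ := (k × k) × k

/-- The one-form `a(t) dt`. -/
def oneForm {A : Type*} [Zero A] (a : A) : Forms A := (0, a)

/-- The Whitney form `dt`. -/
def dt (k : Type*) [Field k] : Whitney k := ((0, 0), 1)

namespace IntervalFunctions

variable {k A : Type*} [Field k] [CommRing A] [Algebra k A] (I : IntervalFunctions k A)

/-- The inclusion `ι : C^* → Ω^*`. -/
def incl : Whitney k →ₗ[k] Forms A :=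
  LinearMap.prodMap
    (I.ofPoly ∘ₗ LinearMap.coprod (LinearMap.toSpanSingleton k k[X] (1 - X))
      (LinearMap.toSpanSingleton k k[X] X))
    (I.ofPoly ∘ₗ LinearMap.toSpanSingleton k k[X] 1)

/-- The projection `π : Ω^* → C^*`, given by `π(f) = f(1) t + f(0) (1 - t)` and
`π(a(t) dt) = (∫_0^1 a(τ) dτ) dt`. -/
def proj : Forms A →ₗ[k] Whitney k :=
  LinearMap.prodMap (LinearMap.prod I.evalZero I.evalOne) (I.evalOne ∘ₗ I.primitive)

/-- Gugenheim's morphism `λ : Ω^* → C^*_∪`: its linear part is `π`, the higher coefficients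
vanish if one of the arguments is a zero-form, and on one-forms they are iterated integrals. -/
def gugenheim : TaylorMaps k (Forms A) (Whitney k)
  | 0 => 0
  | 1 => TaylorMaps.strict I.proj 1
  | n + 2 => LinearMap.compMultilinearMap (LinearMap.toSpanSingleton k (Whitney k) (dt k))
      ((I.simplexIntegral (n + 2)).compLinearMap fun _ => LinearMap.snd k A A)

/-- The coefficient of `dt` in a Whitney form. -/
def dtCoeff (k : Type*) [Field k] : Whitney k →ₗ[k] k := LinearMap.snd k (k × k) k

/-- The coefficient of `t` of a Whitney form with respect to the basis `1, t, dt`: the zero-form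
`b (1 - t) + a t` equals `b · 1 + (a - b) t`. -/
def tCoeff (k : Type*) [Field k] : Whitney k →ₗ[k] k :=
  (LinearMap.snd k k k - LinearMap.fst k k k) ∘ₗ LinearMap.fst k (k × k) k

/-- The morphism `μ : C^*_∞ → Ω^*`. Its linear part is the inclusion. It is unital, and for
`N ≥ 1` the coefficient `μ_{N+1}` vanishes unless precisely one argument is a function, and
`μ_{N+1}(dt^{⊗ i} ⊗ t ⊗ dt^{⊗ (N-i)}) = (-1)^i (N choose i) (B_{N+1}(t) - B_{N+1}) / (N+1)!`.
Below, `N = n + 1`. -/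
def transfer [CharZero k] : TaylorMaps k (Whitney k) (Forms A)
  | 0 => 0
  | 1 => TaylorMaps.strict I.incl 1
  | n + 2 => LinearMap.compMultilinearMap
      (LinearMap.toSpanSingleton k (Forms A)
        (I.ofPoly (((n + 2).factorial : k)⁻¹ •
          ((Polynomial.bernoulli (n + 2)).map (algebraMap ℚ k) -
            C ((_root_.bernoulli (n + 2) : ℚ) : k))), 0))
      (∑ i : Fin (n + 2), ((-1 : k) ^ (i : ℕ) * ((n + 1).choose i : k)) •
        (MultilinearMap.mkPiAlgebra k (Fin (n + 2)) k).compLinearMap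
          fun j => if j = i then tCoeff k else dtCoeff k)

/-- `exp = λ ∘ μ : C^*_∞ → C^*_∪`. -/
def exp [CharZero k] : TaylorMaps k (Whitney k) (Whitney k) := I.gugenheim.comp I.transfer

theorem exp_linear_part [CharZero k] (h : I.proj ∘ₗ I.incl = LinearMap.id) :
    I.exp 1 = TaylorMaps.one k (Whitney k) 1 := by
  refine MultilinearMap.ext fun v => ?_
  rw [exp, TaylorMaps.comp_apply, Finset.sum_eq_single (Composition.ones 1)]
  · rw [TaylorMaps.applyBlocks_ones]
    refine (TaylorMaps.congr_coeff I.gugenheim (w := fun _ : Fin 1 => I.incl (v 0))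
      (Composition.ones_length 1) fun i _ hi => ?_).trans ?_
    · obtain rfl : i = 0 := by lia
      rfl
    · exact LinearMap.congr_fun h (v 0)
  · intro c _ hc
    exact absurd (Composition.eq_ones_iff_le_length.2
      (Composition.length_pos_of_pos c Nat.one_pos)) hc
  · simp

theorem exp_zero_part [CharZero k] : I.exp 0 = 0 := by
  refine MultilinearMap.ext fun v => ?_
  rw [exp, TaylorMaps.comp_apply]
  refine Finset.sum_eq_zero fun c _ => ?_
  have hc : c.length = 0 := Nat.le_zero.1 c.length_le
  rw [TaylorMaps.congr_coeff I.gugenheim (w := Fin.elim0) hc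
    (fun i _ hi => absurd hi (Nat.not_lt_zero i))]
  rfl

/-- `log = exp⁻¹ : C^*_∪ → C^*_∞`. -/
def log [CharZero k] : TaylorMaps k (Whitney k) (Whitney k) := TaylorMaps.inverse I.exp

/-- `log` is a two-sided inverse of `exp`, as soon as `π ∘ ι = id`. -/
theorem log_exp_inverse [CharZero k] (h : I.proj ∘ₗ I.incl = LinearMap.id) :
    I.log.comp I.exp = TaylorMaps.one k (Whitney k) ∧
      I.exp.comp I.log = TaylorMaps.one k (Whitney k) :=
  ⟨TaylorMaps.inverse_comp _ (I.exp_linear_part h),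
    TaylorMaps.comp_inverse _ I.exp_zero_part (I.exp_linear_part h)⟩

/-- `φ = log ∘ λ : Ω^* → C^*_∞`. -/
def phi [CharZero k] : TaylorMaps k (Forms A) (Whitney k) := I.log.comp I.gugenheim

/-- The pullback of forms along `β_s(t) = s t`, where `c` is the map `f(t) ↦ f(s t)` on functions:
`f(t) ↦ f(s t)` and `a(t) dt ↦ s a(s t) dt`. -/
def pullback (s : k) (c : A →ₗ[k] A) : Forms A →ₗ[k] Forms A := LinearMap.prodMap c (s • c)

/-- `φ_s = φ ∘ β_s^*`, where `c` is the map `f(t) ↦ f(s t)` on functions. -/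
def phiScaled [CharZero k] (s : k) (c : A →ₗ[k] A) : TaylorMaps k (Forms A) (Whitney k) :=
  I.phi.comp (TaylorMaps.strict (pullback s c))

/-- The maps `𝓜_n : (Ω⁰)^{⊗ n} → Ω⁰`, evaluated on `a₁ ⊗ ⋯ ⊗ a_n`. For `n ≥ 2` the sum runs over
the ordered partitions `c = (i₁, …, i_l)` of `n - 1` and over `0 ≤ j ≤ l`. With
`p_j = i₁ + ⋯ + i_j = c.boundary j`, the integrand is the product of `a_{p_j + 1}` and of the
`𝓜_{i_h}`, which are filled by the remaining `a`'s in their order. The index in `a` counts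
from `0`, hence `a (c.boundary j)` is `a_{p_j + 1}`. -/
def magnus [CharZero k] : (n : ℕ) → (Fin n → A) → A
  | 0, _ => 0
  | 1, a => I.primitive (a 0)
  | n + 2, a => ∑ c : Composition (n + 1), ∑ j : Fin (c.length + 1),
      (((_root_.bernoulli c.length : ℚ) : k) / (c.length.factorial : k) *
          ((-1) ^ (j : ℕ) * (c.length.choose j : k))) •
        I.primitive (a (c.boundary j) * ∏ h : Fin c.length,
          magnus (c.blocksFun h) ((c.boundary j).removeNth a ∘ c.embedding h))
termination_by n => n
decreasing_by
  have := c.blocksFun_le h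
  lia

end IntervalFunctions

/-! ### Polynomial forms -/

/-- `f ↦ ∫_0^t f` on polynomials. -/
def polynomialPrimitive (k : Type*) [Field k] : k[X] →ₗ[k] k[X] :=
  (Polynomial.basisMonomials k).constr k fun m => monomial (m + 1) ((m + 1 : k)⁻¹)

/-- `p ↦ ∫_{0 ≤ t₁ ≤ ⋯ ≤ t_n ≤ 1} p(t₁, …, t_n) dt₁ ⋯ dt_n` on polynomials, evaluated formally: the
integral of `t₁^{l₁ - 1} ⋯ t_n^{l_n - 1}` is `1 / (l₁ (l₁ + l₂) ⋯ (l₁ + ⋯ + l_n))`. -/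
def mvPolynomialSimplexIntegral (k : Type*) [Field k] (n : ℕ) : MvPolynomial (Fin n) k →ₗ[k] k :=
  (MvPolynomial.basisMonomials (Fin n) k).constr k fun m =>
    (∏ j : Fin n, ∑ i ∈ Finset.Iic j, ((m i : k) + 1))⁻¹

/-- The algebra `k[t]` of polynomial functions on the interval. -/
def polyIntervalFunctions (k : Type*) [Field k] : IntervalFunctions k k[X] where
  ofPoly := LinearMap.id
  evalZero := Polynomial.leval 0
  evalOne := Polynomial.leval 1
  primitive := polynomialPrimitive k
  simplexIntegral n := LinearMap.compMultilinearMap (mvPolynomialSimplexIntegral k n)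
    ((MultilinearMap.mkPiAlgebra k (Fin n) (MvPolynomial (Fin n) k)).compLinearMap
      fun i => (Polynomial.aeval (MvPolynomial.X i : MvPolynomial (Fin n) k)).toLinearMap)

theorem poly_proj_incl (k : Type*) [Field k] :
    (polyIntervalFunctions k).proj ∘ₗ (polyIntervalFunctions k).incl = LinearMap.id := by
  have h1 : polynomialPrimitive k 1 = X := by
    have := (Polynomial.basisMonomials k).constr_basis k
      (fun m => monomial (m + 1) ((m + 1 : k)⁻¹)) 0
    simpa [polynomialPrimitive, Polynomial.coe_basisMonomials, monomial_zero_left] using! this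
  refine LinearMap.ext fun x => ?_
  obtain ⟨⟨b, a⟩, c⟩ := x
  simp [IntervalFunctions.proj, IntervalFunctions.incl, polyIntervalFunctions, h1]

/-- `f(t) ↦ f(s t)` on polynomials. -/
def polynomialScale {k : Type*} [Field k] (s : k) : k[X] →ₗ[k] k[X] :=
  (Polynomial.aeval (C s * X : k[X])).toLinearMap

/-! ### Smooth forms -/

/-- The algebra `C^∞([0,1])` of smooth real functions on the closed interval. -/
def SmoothFun : Subalgebra ℝ (Icc (0 : ℝ) 1 → ℝ) where
  carrier := {f | ∃ g : ℝ → ℝ, ContDiffOn ℝ ∞ g (Icc 0 1) ∧ ∀ x, f x = g x}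
  mul_mem' := by
    rintro f f' ⟨g, hg, h⟩ ⟨g', hg', h'⟩
    exact ⟨g * g', hg.mul hg', fun x => by simp [h, h']⟩
  add_mem' := by
    rintro f f' ⟨g, hg, h⟩ ⟨g', hg', h'⟩
    exact ⟨g + g', hg.add hg', fun x => by simp [h, h']⟩
  algebraMap_mem' r := ⟨fun _ => r, contDiffOn_const, fun _ => rfl⟩

namespace SmoothFun

/-- The extension of a function on `[0,1]` to `ℝ` by constants. -/
def extend (f : SmoothFun) : ℝ → ℝ := IccExtend zero_le_one (f : Icc (0 : ℝ) 1 → ℝ)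

theorem extend_of_mem (f : SmoothFun) {x : ℝ} (hx : x ∈ Icc (0 : ℝ) 1) :
    extend f x = (f : Icc (0 : ℝ) 1 → ℝ) ⟨x, hx⟩ :=
  IccExtend_of_mem _ _ hx

theorem continuous_extend (f : SmoothFun) : Continuous (extend f) := by
  obtain ⟨g, hg, h⟩ := f.2
  refine Continuous.Icc_extend' ?_
  have : (f : Icc (0 : ℝ) 1 → ℝ) = (Icc (0 : ℝ) 1).domRestrict g := funext h
  rw [this]
  exact hg.continuousOn.domRestrict

theorem contDiffOn_extend (f : SmoothFun) : ContDiffOn ℝ ∞ (extend f) (Icc 0 1) := by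
  obtain ⟨g, hg, h⟩ := f.2
  exact hg.congr fun x hx => by rw [extend_of_mem f hx, h]

theorem contDiffOn_integral (f : SmoothFun) :
    ContDiffOn ℝ ∞ (fun x => ∫ t in (0 : ℝ)..x, extend f t) (Icc 0 1) := by
  have hd : ∀ x, HasDerivAt (fun x => ∫ t in (0 : ℝ)..x, extend f t) (extend f x) x := fun x =>
    (continuous_extend f).integral_hasStrictDerivAt 0 x |>.hasDerivAt
  rw [contDiffOn_infty_iff_derivWithin (uniqueDiffOn_Icc zero_lt_one)]
  refine ⟨fun x _ => (hd x).differentiableAt.differentiableWithinAt, (contDiffOn_extend f).congr ?_⟩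
  intro x hx
  exact (hd x).hasDerivWithinAt.derivWithin (uniqueDiffOn_Icc zero_lt_one x hx)

/-- Evaluation at a point of `ℝ` of the extension of `f`. -/
def extEval (x : ℝ) : SmoothFun →ₗ[ℝ] ℝ where
  toFun f := extend f x
  map_add' _ _ := rfl
  map_smul' _ _ := rfl

/-- `f ↦ (s ↦ ∫_0^s f(t) dt)`. -/
def primitive : SmoothFun →ₗ[ℝ] SmoothFun where
  toFun f := ⟨fun x => ∫ t in (0 : ℝ)..x, extend f t, _, contDiffOn_integral f, fun _ => rfl⟩
  map_add' f g := by
    ext x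
    exact intervalIntegral.integral_add ((continuous_extend f).intervalIntegrable _ _)
      ((continuous_extend g).intervalIntegrable _ _)
  map_smul' r f := by
    ext x
    exact intervalIntegral.integral_const_mul r (extend f)

/-- The simplex `{0 ≤ t₁ ≤ ⋯ ≤ t_n ≤ 1}`. -/
def simplex (n : ℕ) : Set (Fin n → ℝ) := {t | (∀ i, t i ∈ Icc (0 : ℝ) 1) ∧ Monotone t}

theorem isCompact_simplex (n : ℕ) : IsCompact (simplex n) := by
  have h : simplex n = (Set.univ.pi fun _ => Icc (0 : ℝ) 1) ∩ {t | Monotone t} := by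
    ext t
    simp only [simplex, Set.mem_ofPred_eq, Set.mem_inter_iff, Set.mem_univ_pi]
  rw [h]
  exact (isCompact_univ_pi fun _ => isCompact_Icc).inter_right isClosed_monotone

/-- `a₁ ⊗ ⋯ ⊗ a_n ↦ a₁(t₁) ⋯ a_n(t_n)`. -/
def pointProduct {n : ℕ} (t : Fin n → ℝ) : MultilinearMap ℝ (fun _ : Fin n => SmoothFun) ℝ :=
  (MultilinearMap.mkPiAlgebra ℝ (Fin n) ℝ).compLinearMap fun i => extEval (t i)

theorem pointProduct_apply {n : ℕ} (t : Fin n → ℝ) (a : Fin n → SmoothFun) :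
    pointProduct t a = ∏ i, extend (a i) (t i) := rfl

theorem integrableOn_simplex {n : ℕ} (a : Fin n → SmoothFun) :
    IntegrableOn (fun t => pointProduct t a) (simplex n) := by
  refine ContinuousOn.integrableOn_compact (isCompact_simplex n) (Continuous.continuousOn ?_)
  simp only [pointProduct_apply]
  exact continuous_finsetProd _ fun i _ => (continuous_extend (a i)).comp (continuous_apply i)

/-- `a₁ ⊗ ⋯ ⊗ a_n ↦ ∫_{0 ≤ t₁ ≤ ⋯ ≤ t_n ≤ 1} a₁(t₁) ⋯ a_n(t_n) dt₁ ⋯ dt_n`. -/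
def simplexIntegral (n : ℕ) : MultilinearMap ℝ (fun _ : Fin n => SmoothFun) ℝ :=
  MultilinearMap.mk' (fun a => ∫ t in simplex n, pointProduct t a)
    (fun a i x y => by
      simp only [MultilinearMap.map_update_add]
      exact integral_add (integrableOn_simplex _) (integrableOn_simplex _))
    (fun a i r x => by
      simp only [MultilinearMap.map_update_smul]
      exact integral_smul r _)

/-- Polynomials as smooth functions on `[0,1]`. -/
def ofPoly : ℝ[X] →ₗ[ℝ] SmoothFun where
  toFun p := ⟨fun x => p.eval (x : ℝ), fun x => p.eval x,
    by simpa [Polynomial.coe_aeval_eq_eval] using! (Polynomial.contDiff_aeval p ∞).contDiffOn (s := Icc (0 : ℝ) 1), fun _ => rfl⟩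
  map_add' p q := by
    ext x
    exact Polynomial.eval_add
  map_smul' r p := by
    ext x
    exact Polynomial.eval_smul r p x

/-- `f(t) ↦ f(s t)` on smooth functions, for `s ∈ [0,1]`. -/
def scale (s : Icc (0 : ℝ) 1) : SmoothFun →ₗ[ℝ] SmoothFun where
  toFun f := ⟨fun x => (f : Icc (0 : ℝ) 1 → ℝ) (s * x), fun x => extend f ((s : ℝ) * x),
    (contDiffOn_extend f).comp (contDiff_const.mul contDiff_id).contDiffOn
      (fun x hx => (s * ⟨x, hx⟩ : Icc (0 : ℝ) 1).2),
    fun x => (extend_of_mem f (s * x).2).symm⟩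
  map_add' _ _ := rfl
  map_smul' _ _ := rfl

end SmoothFun

/-- The algebra of smooth functions on the interval. -/
def smoothIntervalFunctions : IntervalFunctions ℝ SmoothFun where
  ofPoly := SmoothFun.ofPoly
  evalZero := LinearMap.proj 0 ∘ₗ SmoothFun.val.toLinearMap
  evalOne := LinearMap.proj 1 ∘ₗ SmoothFun.val.toLinearMap
  primitive := SmoothFun.primitive
  simplexIntegral := SmoothFun.simplexIntegral

theorem smooth_proj_incl :
    smoothIntervalFunctions.proj ∘ₗ smoothIntervalFunctions.incl = LinearMap.id := by
  have h1 : (SmoothFun.primitive (SmoothFun.ofPoly 1) : Icc (0 : ℝ) 1 → ℝ) 1 = 1 := by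
    have : SmoothFun.extend (SmoothFun.ofPoly 1) = fun _ => 1 := by
      funext x
      simp [SmoothFun.extend, SmoothFun.ofPoly, IccExtend]
    change ∫ t in (0 : ℝ)..(1 : Icc (0 : ℝ) 1), SmoothFun.extend (SmoothFun.ofPoly 1) t = 1
    rw [this]
    simp
  have h2 : ∀ p : ℝ[X], ∀ x, (SmoothFun.ofPoly p : Icc (0 : ℝ) 1 → ℝ) x = p.eval (x : ℝ) :=
    fun _ _ => rfl
  refine LinearMap.ext fun x => ?_
  obtain ⟨⟨b, a⟩, c⟩ := x
  simp [IntervalFunctions.proj, IntervalFunctions.incl, smoothIntervalFunctions, h1, h2]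

/-! ### The two families `φ_s` -/

/-- `φ_s` for polynomial forms, `s ∈ k`. -/
def polyPhi {k : Type*} [Field k] [CharZero k] (s : k) : TaylorMaps k (Forms k[X]) (Whitney k) :=
  (polyIntervalFunctions k).phiScaled s (polynomialScale s)

/-- `φ_s` for smooth forms, `s ∈ [0,1]`. -/
def smoothPhi (s : Icc (0 : ℝ) 1) : TaylorMaps ℝ (Forms SmoothFun) (Whitney ℝ) :=
  smoothIntervalFunctions.phiScaled (s : ℝ) (SmoothFun.scale s)

end

/-! No coefficient of `log` is computed. Since exp ∘ log = id, φ_s satisfies exp ∘ φ_s = λ ∘ β_s^*,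
and on one-forms this equation is explicit. Every higher coefficient of μ vanishes on words in dt
alone, so exp_n on multiples of dt is the simplex volume 1/n! times the product of the coefficients
(`exp_smul_dt`). The right side is the iterated integral with upper bound s. Hence φ_s on one-forms
is the logarithm, for the concatenation product, of the series of iterated integrals, and it is
enough to show that the exponential of 𝓜 is that series (`sum_prod_magnus`). An induction on n then
isolates the coefficient with index n on both sides (`phiScaled_oneForm`).

For the exponential, fix a sequence b and work with upper triangular matrices over Ω⁰ indexed by ℕ:
the entry w(p, q) is 𝓜 of the subword b_p, …, b_{q-1}, and r is the superdiagonal matrix with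
entries b_p. Sums over compositions become matrix products, and the recursion for 𝓜 becomes the
Magnus equation w' = ∑ B_l/l! (ad)^l r, where ad(x) = x w - w x (`magnusEntries_eq_primitive`). By
the Leibniz rule, (e^w)' = ∑ 1/(m+1)! ∑ w^i w' w^{m-i}. Left and right multiplication by w commute;
calling them X and Y, this is (e^Y - e^X)/(Y-X) · (Y-X)/(e^{Y-X}-1) = e^X applied to r, that is
(e^w)' = e^w r (`sum_geom_bernoulliAd`). The iterated integrals obey the same equation
(`sum_pow_magnusEntries`). Since w is strictly triangular, all series are finite in each entry.

Derivatives serve as notation here: the argument uses only the integration by parts identity for f ↦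
∫_0^s f, so it applies to both settings. What remains for each setting is this identity,
compatibility with scaling, and the equality of simplex integrals with iterated ones. -/

noncomputable section

/-! ### The derivative of the exponential and the Bernoulli series -/

namespace BernoulliIdentity

open Finset

/-- In a formal variable z, the first factor is (e^{yz} - e^{xz}) / ((y-x)z) and the second is
(y-x)z / (e^{(y-x)z} - 1). Both denominators are cleared by multiplying with (y-x)z, which is
cancellable because x ≠ y in a domain. -/
theorem powerSeries_geom_sum_mul_bernoulli {C : Type*} [CommRing C] [IsDomain C] [Algebra ℚ C]
    (x y : C) (hxy : x ≠ y) :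
    (PowerSeries.mk fun n => algebraMap ℚ C (1 / (n + 1).factorial) *
        ∑ i ∈ range (n + 1), x ^ i * y ^ (n - i)) *
      PowerSeries.rescale (y - x) (bernoulliPowerSeries C) =
      PowerSeries.rescale x (PowerSeries.exp C) := by
  set H : PowerSeries C := PowerSeries.mk fun n => algebraMap ℚ C (1 / (n + 1).factorial) *
        ∑ i ∈ range (n + 1), x ^ i * y ^ (n - i) with hH
  have hu : y - x ≠ 0 := sub_ne_zero.2 hxy.symm
  have h1 : PowerSeries.C (y - x) * PowerSeries.X * H =
      PowerSeries.rescale y (PowerSeries.exp C) - PowerSeries.rescale x (PowerSeries.exp C) := by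
    ext n
    rw [mul_assoc, PowerSeries.coeff_C_mul]
    cases n with
    | zero =>
      rw [PowerSeries.coeff_zero_X_mul, mul_zero, map_sub, PowerSeries.coeff_rescale,
        PowerSeries.coeff_rescale, pow_zero, pow_zero, sub_self]
    | succ n =>
      rw [PowerSeries.coeff_succ_X_mul, hH, PowerSeries.coeff_mk, map_sub,
        PowerSeries.coeff_rescale, PowerSeries.coeff_rescale, PowerSeries.coeff_exp]
      have := (Commute.all x y).geom_sum₂_mul (n + 1)
      simp only [Nat.add_sub_cancel] at this
      linear_combination (-algebraMap ℚ C (1 / (n + 1).factorial)) * this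
  have h2 : PowerSeries.rescale (y - x) (bernoulliPowerSeries C) *
      (PowerSeries.rescale (y - x) (PowerSeries.exp C) - 1) =
      PowerSeries.C (y - x) * PowerSeries.X := by
    rw [← PowerSeries.rescale_X, ← bernoulliPowerSeries_mul_exp_sub_one, map_mul, map_sub, map_one]
  have h3 : PowerSeries.rescale x (PowerSeries.exp C) *
      PowerSeries.rescale (y - x) (PowerSeries.exp C) =
      PowerSeries.rescale y (PowerSeries.exp C) := by
    rw [PowerSeries.exp_mul_exp_eq_exp_add, add_sub_cancel]
  have h4 : (PowerSeries.C (y - x) * PowerSeries.X : PowerSeries C) ≠ 0 :=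
    mul_ne_zero ((map_ne_zero_iff _ PowerSeries.C_injective).2 hu) PowerSeries.X_ne_zero
  apply mul_left_cancel₀ h4
  linear_combination (PowerSeries.rescale (y - x) (bernoulliPowerSeries C)) * h1 -
    (PowerSeries.rescale (y - x) (bernoulliPowerSeries C)) * h3 +
    (PowerSeries.rescale x (PowerSeries.exp C)) * h2

theorem sum_geom_sum_mul_bernoulli {C : Type*} [CommRing C] [IsDomain C] [Algebra ℚ C]
    (x y : C) (hxy : x ≠ y) (q : ℕ) :
    ∑ m ∈ range (q + 1), (algebraMap ℚ C (1 / (m + 1).factorial) *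
        ∑ i ∈ range (m + 1), x ^ i * y ^ (m - i)) *
      (algebraMap ℚ C (_root_.bernoulli (q - m) / (q - m).factorial) * (y - x) ^ (q - m)) =
      algebraMap ℚ C (1 / q.factorial) * x ^ q := by
  have h := congrArg (PowerSeries.coeff q) (powerSeries_geom_sum_mul_bernoulli x y hxy)
  rw [PowerSeries.coeff_mul, Finset.Nat.sum_antidiagonal_eq_sum_range_succ_mk,
    PowerSeries.coeff_rescale, PowerSeries.coeff_exp] at h
  rw [mul_comm, ← h]
  refine Finset.sum_congr rfl fun m _ => ?_
  simp only [PowerSeries.coeff_mk, PowerSeries.coeff_rescale, bernoulliPowerSeries]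
  ring

variable {k : Type*} [Field k] {R : Type*} [Ring R] [Algebra k R]

/-- The action of `k[X][Y]` on `R` such that `X` and `Y` act by left and right multiplication
with `w`. -/
def bimul (k : Type*) [Field k] {R : Type*} [Ring R] [Algebra k R] (w : R) :
    k[X][X] →+* Module.End k R :=
  Polynomial.eval₂RingHom' (Polynomial.aeval (LinearMap.mulLeft k w)).toRingHom
    (LinearMap.mulRight k w) fun p => by
      have h : Commute (LinearMap.mulLeft k w) (LinearMap.mulRight k w) :=
        LinearMap.commute_mulLeft_right w w
      change Commute (Polynomial.aeval (LinearMap.mulLeft k w) p) _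
      induction p using Polynomial.induction_on' with
      | add p q hp hq => rw [map_add]; exact hp.add_left hq
      | monomial n a =>
        rw [Polynomial.aeval_monomial]
        exact (Algebra.commute_algebraMap_left a _).mul_left (h.pow_left n)

theorem bimul_X (w r : R) : bimul k w (C X) r = w * r := by
  simp [bimul, Polynomial.eval₂RingHom']

theorem bimul_Y (w r : R) : bimul k w X r = r * w := by
  simp [bimul, Polynomial.eval₂RingHom']

theorem bimul_C (w r : R) (a : k) : bimul k w (C (C a)) r = a • r := by
  simp [bimul, Polynomial.eval₂RingHom', Module.algebraMap_end_apply]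

theorem bimul_mul (w r : R) (p q : k[X][X]) :
    bimul k w (p * q) r = bimul k w p (bimul k w q r) := by
  rw [map_mul]; rfl

theorem bimul_X_pow (w r : R) (n : ℕ) : bimul k w (C X ^ n) r = w ^ n * r := by
  induction n with
  | zero => simp
  | succ n ih => rw [pow_succ', bimul_mul, ih, bimul_X, pow_succ', mul_assoc]

theorem bimul_Y_pow (w r : R) (n : ℕ) : bimul k w (X ^ n) r = r * w ^ n := by
  induction n with
  | zero => simp
  | succ n ih => rw [pow_succ', bimul_mul, ih, bimul_Y, pow_succ, mul_assoc]

theorem bimul_algebraMap [CharZero k] (w r : R) (a : ℚ) :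
    bimul k w (algebraMap ℚ k[X][X] a) r = (a : k) • r := by
  have : algebraMap ℚ k[X][X] a = C (C (a : k)) := rfl
  rw [this, bimul_C]

/-- `(r ↦ r w - w r)^l`, expanded. -/
theorem bimul_sub_pow (w r : R) (l : ℕ) :
    bimul k w ((X - C X) ^ l) r =
      ∑ j ∈ range (l + 1), ((-1 : k) ^ j * (l.choose j : k)) • (w ^ j * r * w ^ (l - j)) := by
  rw [sub_eq_neg_add, add_pow, map_sum, LinearMap.sum_apply]
  refine Finset.sum_congr rfl fun j _ => ?_
  have : ((-(C X : k[X][X])) ^ j * X ^ (l - j) * (l.choose j : k[X][X])) =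
      C (C ((-1 : k) ^ j * (l.choose j : k))) * (C X ^ j * X ^ (l - j)) := by
    rw [neg_pow]; simp; ring
  rw [this, bimul_mul, bimul_C, bimul_mul, bimul_Y_pow, bimul_X_pow, mul_assoc]

/-- The right hand side `∑ B_l / l! (r ↦ r w - w r)^l` of the differential equation for `w = log S`,
where `S' = S r`, truncated at order `n`. -/
def bernoulliAd (k : Type*) [Field k] {R : Type*} [Ring R] [Algebra k R] (n : ℕ) (w r : R) : R :=
  ∑ l ∈ range n, (((_root_.bernoulli l : ℚ) : k) / (l.factorial : k)) •
    ∑ j ∈ range (l + 1), ((-1 : k) ^ j * (l.choose j : k)) • (w ^ j * r * w ^ (l - j))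

theorem sum_sum_eq_sum_range_diag {M : Type*} [AddCommMonoid M] (n : ℕ) (f : ℕ → ℕ → M)
    (h : ∀ i j, n ≤ i + j → f i j = 0) :
    ∑ i ∈ range n, ∑ j ∈ range n, f i j = ∑ q ∈ range n, ∑ i ∈ range (q + 1), f i (q - i) := by
  rw [Finset.sum_range_diag_flip]
  refine Finset.sum_congr rfl fun i _ => ?_
  refine (Finset.sum_subset (fun j hj => ?_) fun j _ hj => h i j ?_).symm
  · rw [Finset.mem_range] at *; omega
  · rw [Finset.mem_range] at hj; omega

/-- The formula for the derivative of the exponential inverts `bernoulliAd`. -/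
theorem sum_geom_bernoulliAd [CharZero k] {M : Type*} [AddCommGroup M] [Module k M] (ev : R →ₗ[k] M)
    (n : ℕ) (w r : R) (hn : ∀ i j, n ≤ i + j → ev (w ^ i * r * w ^ j) = 0) :
    ev (∑ m ∈ range n, ((m + 1).factorial : k)⁻¹ •
      ∑ i ∈ range (m + 1), w ^ i * bernoulliAd k n w r * w ^ (m - i)) =
    ev (∑ q ∈ range n, (q.factorial : k)⁻¹ • (w ^ q * r)) := by
  -- Everything of total degree at least n dies under `ev`; the factors Y - X are expanded one at a
  -- time, which keeps the total degree.
  have hv : ∀ m i j, n ≤ i + j + m → ev (bimul k w (C X ^ i * X ^ j * (X - C X) ^ m) r) = 0 := by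
    intro m
    induction m with
    | zero =>
      intro i j hij
      rw [pow_zero, mul_one, bimul_mul, bimul_Y_pow, bimul_X_pow, ← mul_assoc]
      exact hn i j hij
    | succ m ih =>
      intro i j hij
      have : (C X ^ i * X ^ j * (X - C X) ^ (m + 1) : k[X][X]) =
        C X ^ i * X ^ (j + 1) * (X - C X) ^ m - C X ^ (i + 1) * X ^ j * (X - C X) ^ m := by ring
      rw [this, map_sub, LinearMap.sub_apply, map_sub, ih i (j + 1) (by omega),
        ih (i + 1) j (by omega), sub_zero]
  -- Degree m part of (e^Y - e^X)/(Y-X), times degree l part of the Bernoulli series in Y - X. The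
  -- sum over m, l < n can be regrouped by m + l = q < n, since the rest is killed by `ev`.
  let f : ℕ → ℕ → k[X][X] := fun m l =>
    (algebraMap ℚ k[X][X] (1 / (m + 1).factorial) *
        ∑ i ∈ range (m + 1), C X ^ i * X ^ (m - i)) *
      (algebraMap ℚ k[X][X] (_root_.bernoulli l / l.factorial) * (X - C X) ^ l)
  have hf : ∀ m l, n ≤ m + l → ev (bimul k w (f m l) r) = 0 := by
    intro m l hml
    have : f m l = ∑ i ∈ range (m + 1),
        algebraMap ℚ k[X][X] (1 / (m + 1).factorial * (_root_.bernoulli l / l.factorial)) *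
          (C X ^ i * X ^ (m - i) * (X - C X) ^ l) := by
      simp only [f]
      rw [Finset.mul_sum, Finset.sum_mul, map_mul]
      refine Finset.sum_congr rfl fun i _ => by ring
    rw [this, map_sum, LinearMap.sum_apply, map_sum]
    refine Finset.sum_eq_zero fun i hi => ?_
    rw [Finset.mem_range] at hi
    rw [bimul_mul, bimul_algebraMap, map_smul, hv l i (m - i) (by omega), smul_zero]
  have hL : bernoulliAd k n w r = ∑ l ∈ range n,
      bimul k w (algebraMap ℚ k[X][X] (_root_.bernoulli l / l.factorial) * (X - C X) ^ l) r := by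
    rw [bernoulliAd]
    refine Finset.sum_congr rfl fun l _ => ?_
    rw [bimul_mul, bimul_algebraMap, bimul_sub_pow]
    push_cast
    rfl
  have hleft : ∑ m ∈ range n, ((m + 1).factorial : k)⁻¹ •
      ∑ i ∈ range (m + 1), w ^ i * bernoulliAd k n w r * w ^ (m - i) =
      ∑ m ∈ range n, ∑ l ∈ range n, bimul k w (f m l) r := by
    refine Finset.sum_congr rfl fun m _ => ?_
    simp only [f]
    rw [Finset.sum_congr rfl fun l _ => bimul_mul w r _ _, ← map_sum, ← hL, bimul_mul,
      bimul_algebraMap, map_sum, LinearMap.sum_apply]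
    congr 1
    · push_cast; rw [one_div]
    · refine Finset.sum_congr rfl fun i _ => ?_
      rw [bimul_mul, bimul_Y_pow, bimul_X_pow, mul_assoc]
  have hne : (C X : k[X][X]) ≠ X := fun h => by
    have := congrArg (fun p => Polynomial.coeff p 1) h
    simp at this
  rw [hleft, map_sum]
  simp only [map_sum ev]
  rw [sum_sum_eq_sum_range_diag n _ hf]
  refine Finset.sum_congr rfl fun q _ => ?_
  rw [← map_sum, ← LinearMap.sum_apply, ← map_sum, sum_geom_sum_mul_bernoulli _ _ hne, bimul_mul,
    bimul_algebraMap, bimul_X_pow]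
  push_cast
  rw [one_div]

end BernoulliIdentity

/-! ### Sums over compositions as products in an incidence algebra -/

/-- Peeling off the first block, of size i + 1, mirrors the expansion of a matrix product along its
first intermediate index. -/
theorem Composition.sum_blocks_succ {M : Type*} [AddCommMonoid M] (n : ℕ) (F : List ℕ → M) :
    ∑ c : Composition (n + 1), F c.blocks =
      ∑ i ∈ Finset.range (n + 1), ∑ c : Composition (n - i), F ((i + 1) :: c.blocks) := by
  rw [Finset.sum_sigma']
  symm
  refine Finset.sum_bij
    (fun x hx => (⟨(x.1 + 1) :: x.2.blocks, fun {i} hi => ?_, ?_⟩ : Composition (n + 1)))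
    (fun _ _ => Finset.mem_univ _) ?_ ?_ (fun _ _ => rfl)
  · rcases List.mem_cons.1 hi with rfl | h
    · omega
    · exact x.2.blocks_pos h
  · simp only [Finset.mem_sigma, Finset.mem_range] at hx
    rw [List.sum_cons, x.2.blocks_sum]
    omega
  · rintro ⟨i, c⟩ _ ⟨j, d⟩ _ h
    simp only [Composition.mk.injEq, List.cons.injEq, add_left_inj] at h
    obtain ⟨rfl, h⟩ := h
    exact Sigma.ext rfl (heq_of_eq (Composition.ext h))
  · rintro ⟨l, hpos, hsum⟩ _
    match l with
    | [] => simp at hsum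
    | b :: bs =>
      have hb : 0 < b := hpos (by simp)
      rw [List.sum_cons] at hsum
      refine ⟨⟨b - 1, ⟨bs, fun hi => hpos (List.mem_cons_of_mem _ hi), by omega⟩⟩, ?_, ?_⟩
      · simp only [Finset.mem_sigma, Finset.mem_range, Finset.mem_univ, and_true]
        omega
      · apply Composition.ext
        change (b - 1 + 1) :: bs = b :: bs
        rw [Nat.sub_add_cancel hb]

namespace IncidenceAlgebra

variable {A : Type*} [CommRing A]

/-- The product of the entries of the elements of a list along the path with given start and given
steps. -/
def pathProd : List (IncidenceAlgebra A ℕ) → ℕ → List ℕ → A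
  | [], _, [] => 1
  | [], _, _ :: _ => 0
  | _ :: _, _, [] => 0
  | G :: Gs, p, b :: bs => G p (p + b) * pathProd Gs (p + b) bs

theorem pathProd_of_length_ne (Gs : List (IncidenceAlgebra A ℕ)) (p : ℕ) (bs : List ℕ)
    (h : bs.length ≠ Gs.length) : pathProd Gs p bs = 0 := by
  induction Gs generalizing p bs with
  | nil => cases bs with
    | nil => simp at h
    | cons b bs => rfl
  | cons G Gs ih => cases bs with
    | nil => rfl
    | cons b bs => rw [pathProd, ih _ _ (by simpa using h), mul_zero]

theorem pathProd_eq_prod (Gs : List (IncidenceAlgebra A ℕ)) (p : ℕ) (bs : List ℕ)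
    (h : bs.length = Gs.length) : pathProd Gs p bs =
      ∏ i : Fin bs.length, Gs.getD i 0 (p + (bs.take i).sum) (p + (bs.take (i + 1)).sum) := by
  induction Gs generalizing p bs with
  | nil => cases bs with
    | nil => simp [pathProd]
    | cons b bs => simp at h
  | cons G Gs ih => cases bs with
    | nil => simp at h
    | cons b bs =>
      rw [pathProd, ih _ _ (by simpa using h)]
      refine ((Fin.prod_univ_succ (n := bs.length) _).trans ?_).symm
      refine congrArg₂ (· * ·) (by simp) (Finset.prod_congr rfl fun i _ => ?_)
      simp only [Fin.val_succ, List.getD_cons_succ, List.take_succ_cons, List.sum_cons,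
        ← add_assoc]

/-- The common induction step of `sum_pathProd` and `sum_mul_pathProd`. The first block b is the
step from p to the intermediate index p + b; blocks are positive, so the diagonal of G has to
vanish. -/
theorem sum_composition_mul (Φ Φ' : ℕ → List ℕ → A) (G F : IncidenceAlgebra A ℕ)
    (hG : ∀ i, G i i = 0)
    (hΦ : ∀ p n, ∑ c : Composition n, Φ p c.blocks = F p (p + n))
    (hnil : ∀ p, Φ' p [] = 0)
    (hcons : ∀ p b bs, Φ' p (b :: bs) = G p (p + b) * Φ (p + b) bs) (p n : ℕ) :
    ∑ c : Composition n, Φ' p c.blocks = (G * F) p (p + n) := by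
  cases n with
  | zero =>
    rw [add_zero, mul_apply, Finset.Icc_self, Finset.sum_singleton, hG, zero_mul]
    refine Finset.sum_eq_zero fun c _ => ?_
    rw [c.blocks_eq_nil.2 rfl, hnil]
  | succ n =>
    have hI : Finset.Icc p (p + (n + 1)) = Finset.Ico p (p + (n + 1 + 1)) := by
      ext x
      rw [Finset.mem_Icc, Finset.mem_Ico]
      omega
    rw [Composition.sum_blocks_succ, mul_apply, hI, Finset.sum_Ico_eq_sum_range,
      Nat.add_sub_cancel_left, Finset.sum_range_succ' _ (n + 1), add_zero, hG, zero_mul, add_zero]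
    refine Finset.sum_congr rfl fun i hi => ?_
    rw [Finset.mem_range] at hi
    simp only [hcons]
    rw [← Finset.mul_sum, hΦ, show p + (i + 1) + (n - i) = p + (n + 1) by omega]

/-- The incidence algebra element supported on the diagonal. -/
def diag (b : ℕ → A) : IncidenceAlgebra A ℕ :=
  ⟨fun p q => if p = q then b p else 0, fun _ _ h => if_neg fun e => h e.le⟩

/-- An entry of a matrix product is a sum over chains from p to p + n. Vanishing diagonals leave the
strict chains, which are the compositions of n with one block per factor. -/
theorem sum_pathProd (Gs : List (IncidenceAlgebra A ℕ)) (hG : ∀ G ∈ Gs, ∀ i, G i i = 0) (p n : ℕ) :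
    ∑ c : Composition n, pathProd Gs p c.blocks = Gs.prod p (p + n) := by
  induction Gs generalizing p n with
  | nil =>
    rw [List.prod_nil, one_apply]
    cases n with
    | zero =>
      rw [Fintype.sum_eq_single (Composition.ones 0) fun c hc => (hc ?_).elim]
      · simp [pathProd]
      · exact Composition.ext (by rw [c.blocks_eq_nil.2 rfl, (Composition.ones 0).blocks_eq_nil.2 rfl])
    | succ n =>
      rw [if_neg (by omega), Composition.sum_blocks_succ]
      exact Finset.sum_eq_zero fun _ _ => Finset.sum_eq_zero fun _ _ => rfl
  | cons G Gs ih =>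
    rw [List.prod_cons]
    exact sum_composition_mul (pathProd Gs) (pathProd (G :: Gs)) G Gs.prod (hG G (by simp))
      (ih fun G' h => hG G' (by simp [h])) (fun _ => rfl) (fun _ _ _ => rfl) p n

theorem diag_mul_apply (b : ℕ → A) (F : IncidenceAlgebra A ℕ) (p q : ℕ) :
    (diag b * F) p q = b p * F p q := by
  by_cases h : p ≤ q
  · rw [mul_apply, Finset.sum_eq_single p]
    · simp [diag]
    · intro x _ hx
      change (if p = x then b p else 0) * _ = 0
      rw [if_neg hx.symm, zero_mul]
    · intro hp
      exact (hp (Finset.left_mem_Icc.2 h)).elim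
  · rw [apply_eq_zero_of_not_le h, apply_eq_zero_of_not_le h, mul_zero]

/-- The weighted version, with b taken at the point reached after the blocks of `Gs`. In the
recursion for `magnus` this weight is the distinguished letter a_{p_j+1}. -/
theorem sum_mul_pathProd (b : ℕ → A) (Gs Hs : List (IncidenceAlgebra A ℕ))
    (hG : ∀ G ∈ Gs, ∀ i, G i i = 0) (hH : ∀ G ∈ Hs, ∀ i, G i i = 0) (p n : ℕ) :
    ∑ c : Composition n, b (p + (c.blocks.take Gs.length).sum) * pathProd (Gs ++ Hs) p c.blocks =
      (Gs.prod * diag b * Hs.prod) p (p + n) := by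
  induction Gs generalizing p n with
  | nil =>
    rw [List.prod_nil, one_mul, diag_mul_apply, ← sum_pathProd Hs hH, Finset.mul_sum]
    simp
  | cons G Gs ih =>
    rw [List.prod_cons, mul_assoc, mul_assoc, ← mul_assoc Gs.prod]
    refine sum_composition_mul (fun p bs => b (p + (bs.take Gs.length).sum) *
      pathProd (Gs ++ Hs) p bs) (fun p bs => b (p + (bs.take (G :: Gs).length).sum) *
      pathProd ((G :: Gs) ++ Hs) p bs) G _ (hG G (by simp))
      (ih fun G' h => hG G' (by simp [h])) (fun _ => ?_) (fun p c bs => ?_) p n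
    · simp [pathProd]
    · simp only [List.cons_append, pathProd, List.length_cons, List.take_succ_cons, List.sum_cons,
        add_assoc]
      ring

/-- The translate of an element of the incidence algebra. -/
def shift (f : IncidenceAlgebra A ℕ) : IncidenceAlgebra A ℕ :=
  ⟨fun p q => f (p + 1) (q + 1), fun _ _ h => apply_eq_zero_of_not_le (by omega) f⟩

theorem shift_apply (f : IncidenceAlgebra A ℕ) (p q : ℕ) : shift f p q = f (p + 1) (q + 1) := rfl

theorem shift_mul (f g : IncidenceAlgebra A ℕ) : shift (f * g) = shift f * shift g := by
  ext p q
  rw [shift_apply, mul_apply, mul_apply, ← Finset.map_add_right_Icc, Finset.sum_map]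
  rfl

theorem shift_one : shift (1 : IncidenceAlgebra A ℕ) = 1 := by
  ext p q
  simp [shift_apply]

theorem shift_pow (f : IncidenceAlgebra A ℕ) (n : ℕ) : shift (f ^ n) = shift f ^ n := by
  induction n with
  | zero => rw [pow_zero, pow_zero, shift_one]
  | succ n ih => rw [pow_succ, pow_succ, shift_mul, ih]

/-- The incidence algebra element supported on the first superdiagonal. -/
def superdiag (b : ℕ → A) : IncidenceAlgebra A ℕ :=
  ⟨fun p q => if p + 1 = q then b p else 0, fun _ _ h => if_neg fun e => h (by omega)⟩

theorem superdiag_mul_apply (b : ℕ → A) (F : IncidenceAlgebra A ℕ) (p q : ℕ) :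
    (superdiag b * F) p q = b p * F (p + 1) q := by
  by_cases h : p + 1 ≤ q
  · rw [mul_apply, Finset.sum_eq_single (p + 1)]
    · simp [superdiag]
    · intro x _ hx
      change (if p + 1 = x then b p else 0) * _ = 0
      rw [if_neg hx.symm, zero_mul]
    · intro hp
      exact (hp (Finset.mem_Icc.2 ⟨by omega, h⟩)).elim
  · rw [apply_eq_zero_of_not_le h, mul_zero, mul_apply]
    refine Finset.sum_eq_zero fun x hx => ?_
    rw [Finset.mem_Icc] at hx
    change (if p + 1 = x then b p else 0) * _ = 0
    rw [if_neg (by omega), zero_mul]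

theorem mul_superdiag_apply (b : ℕ → A) (F : IncidenceAlgebra A ℕ) (p q : ℕ) :
    (F * superdiag b) p (q + 1) = F p q * b q := by
  by_cases h : p ≤ q
  · rw [mul_apply, Finset.sum_eq_single q]
    · simp [superdiag]
    · intro x _ hx
      change _ * (if x + 1 = q + 1 then b x else 0) = 0
      rw [if_neg (by omega), mul_zero]
    · intro hp
      exact (hp (Finset.mem_Icc.2 ⟨h, by omega⟩)).elim
  · rw [apply_eq_zero_of_not_le h, zero_mul, mul_apply]
    refine Finset.sum_eq_zero fun x hx => ?_
    rw [Finset.mem_Icc] at hx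
    change _ * (if x + 1 = q + 1 then b x else 0) = 0
    rw [if_neg (by omega), mul_zero]

/-- The superdiagonal factor consumes one letter. After its deletion the word is one shorter, and
whatever follows it is read one position further on: hence `shift`, and q in place of q + 1. -/
theorem mul_superdiag_mul_apply (b : ℕ → A) (F G : IncidenceAlgebra A ℕ) (p q : ℕ) :
    (F * superdiag b * G) p (q + 1) = (F * diag b * shift G) p q := by
  rw [mul_assoc, mul_assoc, mul_apply, mul_apply]
  simp only [superdiag_mul_apply, diag_mul_apply, shift_apply]
  refine (Finset.sum_subset (fun x hx => ?_) fun x hx hx' => ?_).symm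
  · rw [Finset.mem_Icc] at *; omega
  · rw [Finset.mem_Icc] at *
    rw [apply_eq_zero_of_not_le (by omega : ¬ (x + 1 ≤ q + 1)), mul_zero, mul_zero]

theorem mul_apply_eq_zero {f g : IncidenceAlgebra A ℕ} {m n : ℕ}
    (hf : ∀ p q, q < p + m → f p q = 0) (hg : ∀ p q, q < p + n → g p q = 0) (p q : ℕ)
    (h : q < p + (m + n)) : (f * g) p q = 0 := by
  rw [mul_apply]
  refine Finset.sum_eq_zero fun x _ => ?_
  by_cases hx : x < p + m
  · rw [hf p x hx, zero_mul]
  · rw [hg x q (by omega), mul_zero]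

theorem pow_apply_eq_zero {f : IncidenceAlgebra A ℕ} (hf : ∀ i, f i i = 0) (m : ℕ) (p q : ℕ)
    (h : q < p + m) : (f ^ m) p q = 0 := by
  induction m generalizing p q with
  | zero => exact apply_eq_zero_of_not_le (by omega) _
  | succ m ih =>
    rw [pow_succ]
    refine mul_apply_eq_zero ih (n := 1) (fun p q hpq => ?_) p q h
    rcases eq_or_ne p q with rfl | hne
    · exact hf p
    · exact apply_eq_zero_of_not_le (by omega) _

/-- Each of the i + j + 1 factors raises the index by at least one. This nilpotence makes the
exponential and Bernoulli series finite in each entry. -/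
theorem pow_mul_superdiag_mul_pow_apply_eq_zero {f : IncidenceAlgebra A ℕ} (hf : ∀ i, f i i = 0)
    (b : ℕ → A) (i j : ℕ) (p q : ℕ) (h : q < p + (i + j + 1)) :
    (f ^ i * superdiag b * f ^ j) p q = 0 := by
  refine mul_apply_eq_zero (m := i + 1) (n := j) (mul_apply_eq_zero (pow_apply_eq_zero hf i)
    (n := 1) fun p q hpq => if_neg (by omega)) (pow_apply_eq_zero hf j) p q (by omega)

/-- An entry, as a linear map. -/
def entry (k : Type*) [CommRing k] [Algebra k A] (p q : ℕ) : IncidenceAlgebra A ℕ →ₗ[k] A where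
  toFun f := f p q
  map_add' _ _ := rfl
  map_smul' _ _ := rfl

/-! ### Rota–Baxter operators, applied to entries -/

variable {k : Type*} [CommRing k] [Algebra k A] {P : A →ₗ[k] A}

theorem mul_eq_primitive (hP : ∀ f g, P f * P g = P (f * P g + P f * g)) {n : ℕ}
    {x x' y y' : IncidenceAlgebra A ℕ} (hx : ∀ p q, q ≤ n → x p q = P (x' p q))
    (hy : ∀ p q, q ≤ n → y p q = P (y' p q)) (p q : ℕ) (hq : q ≤ n) :
    (x * y) p q = P ((x' * y + x * y') p q) := by
  rw [add_apply, mul_apply, mul_apply, mul_apply, ← Finset.sum_add_distrib, map_sum]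
  refine Finset.sum_congr rfl fun z hz => ?_
  rw [Finset.mem_Icc] at hz
  rw [hx p z (by omega), hy z q hq, hP]

/-- The noncommutative Leibniz rule in integrated form, with x' in the role of the derivative of x.
Only columns up to n are involved, because the Magnus equation with a truncated series holds only
there. -/
theorem pow_eq_primitive (hP : ∀ f g, P f * P g = P (f * P g + P f * g)) {n : ℕ}
    {x x' : IncidenceAlgebra A ℕ} (hx : ∀ p q, q ≤ n → x p q = P (x' p q)) (m p q : ℕ)
    (hq : q ≤ n) :
    (x ^ (m + 1)) p q = P ((∑ i ∈ Finset.range (m + 1), x ^ i * x' * x ^ (m - i)) p q) := by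
  induction m generalizing p q with
  | zero => simpa using hx p q hq
  | succ m ih =>
    rw [pow_succ', mul_eq_primitive hP hx ih p q hq, Finset.sum_range_succ' _ (m + 1),
      Finset.mul_sum, add_comm]
    have h : ∑ i ∈ Finset.range (m + 1), x * (x ^ i * x' * x ^ (m - i)) =
        ∑ i ∈ Finset.range (m + 1), x ^ (i + 1) * x' * x ^ (m + 1 - (i + 1)) :=
      Finset.sum_congr rfl fun i _ => by
        rw [Nat.add_sub_add_right, pow_succ', mul_assoc, mul_assoc, mul_assoc]
    rw [h, pow_zero, one_mul, Nat.sub_zero]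

end IncidenceAlgebra

/-! ### The Magnus recursion as a matrix equation, and its exponential -/

namespace IntervalFunctions

variable {k A : Type*} [Field k] [CommRing A] [Algebra k A] (I : IntervalFunctions k A)

/-- Iterated integrals, as functions of the upper bound. -/
def iterated : (n : ℕ) → MultilinearMap k (fun _ : Fin n => A) A
  | 0 => MultilinearMap.constOfIsEmpty k _ 1
  | n + 1 => (((LinearMap.mul k A).compr₂ I.primitive).compMultilinearMap
      (iterated n)).uncurryRight

theorem iterated_zero (a : Fin 0 → A) : I.iterated 0 a = 1 := rfl

theorem iterated_succ (n : ℕ) (a : Fin (n + 1) → A) :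
    I.iterated (n + 1) a = I.primitive (I.iterated n (Fin.init a) * a (Fin.last n)) := rfl

variable [CharZero k]

theorem magnus_congr {m n : ℕ} {v : Fin m → A} {w : Fin n → A} (h : m = n)
    (hv : ∀ (i : ℕ) (him : i < m) (hin : i < n), v ⟨i, him⟩ = w ⟨i, hin⟩) :
    I.magnus m v = I.magnus n w := by
  subst h
  congr with ⟨i, hi⟩
  exact hv i hi hi

/-- The values of `magnus` on the subwords of a sequence. -/
def magnusEntries (b : ℕ → A) : IncidenceAlgebra A ℕ :=
  ⟨fun p q => I.magnus (q - p) fun i => b (p + i), fun p q h => by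
    rw [I.magnus_congr (w := fun i : Fin 0 => i.elim0) (by omega) fun i _ hi => absurd hi (by omega),
      magnus]⟩

theorem magnusEntries_apply (b : ℕ → A) (p q : ℕ) :
    I.magnusEntries b p q = I.magnus (q - p) fun i => b (p + i) := rfl

theorem magnusEntries_self (b : ℕ → A) (p : ℕ) : I.magnusEntries b p p = 0 := by
  rw [magnusEntries_apply, I.magnus_congr (w := fun i : Fin 0 => i.elim0) (by omega)
    fun i _ hi => absurd hi (by omega), magnus]

open IncidenceAlgebra BernoulliIdentity

/-- Block boundaries include the deleted position, so each block lies entirely before it, and reads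
the original word, or entirely after it, and reads the word shifted by one. -/
theorem prod_magnus_removeNth (b : ℕ → A) (p n : ℕ) (c : Composition (n + 1))
    (j : Fin (c.length + 1)) :
    ∏ h : Fin c.length, I.magnus (c.blocksFun h)
      ((c.boundary j).removeNth (fun i : Fin (n + 2) => b (p + i)) ∘ c.embedding h) =
    pathProd (List.replicate j (I.magnusEntries b) ++
      List.replicate (c.length - j) (shift (I.magnusEntries b))) p c.blocks := by
  have hj : (j : ℕ) ≤ c.length := Nat.lt_succ_iff.1 j.2
  rw [pathProd_eq_prod _ _ _ (by
    rw [List.length_append, List.length_replicate, List.length_replicate, c.blocks_length]; omega)]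
  refine Finset.prod_congr rfl fun h _ => ?_
  have hsucc : c.sizeUpTo (h + 1) = c.sizeUpTo h + c.blocksFun h := c.sizeUpTo_succ' h
  have hb : (c.boundary j : ℕ) = c.sizeUpTo j := rfl
  change _ = (List.getD _ (h : ℕ) 0 : IncidenceAlgebra A ℕ) (p + c.sizeUpTo h) (p + c.sizeUpTo (h + 1))
  rw [hsucc]
  by_cases hh : (h : ℕ) < j
  · have hm : c.sizeUpTo (h + 1) ≤ c.sizeUpTo j := c.monotone_sizeUpTo hh
    rw [List.getD_append _ _ _ _ (by simpa using hh), List.getD_replicate _ hh,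
      magnusEntries_apply]
    refine I.magnus_congr (by omega) fun i hi _ => ?_
    simp only [Function.comp_apply, Fin.removeNth]
    rw [Fin.succAbove_of_castSucc_lt]
    · simp [add_assoc]
    · rw [Fin.lt_def, Fin.val_castSucc, c.coe_embedding, hb]
      simp only
      omega
  · have hm : c.sizeUpTo j ≤ c.sizeUpTo h := c.monotone_sizeUpTo (not_lt.1 hh)
    have hlt : (h : ℕ) - j < c.length - j := by have := h.2; omega
    rw [List.getD_append_right _ _ _ _ (by simpa using hh), List.length_replicate,
      List.getD_replicate _ hlt, shift_apply, magnusEntries_apply]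
    refine I.magnus_congr (by omega) fun i hi _ => ?_
    simp only [Function.comp_apply, Fin.removeNth]
    rw [Fin.succAbove_of_le_castSucc]
    · simp only [Fin.val_succ, c.coe_embedding]
      congr 1
      omega
    · rw [Fin.le_def, Fin.val_castSucc, c.coe_embedding, hb]
      simp only
      omega

theorem magnus_add_two (b : ℕ → A) (p n K : ℕ) (hK : n + 1 < K) :
    I.magnus (n + 2) (fun i => b (p + i)) =
      I.primitive (bernoulliAd k K (I.magnusEntries b) (superdiag b) p (p + (n + 2))) := by
  set w := I.magnusEntries b with hw
  have hw0 : ∀ i, w i i = 0 := I.magnusEntries_self b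
  have hs0 : ∀ i, shift w i i = 0 := fun i => hw0 (i + 1)
  let wt : ℕ → ℕ → k := fun l j =>
    ((_root_.bernoulli l : ℚ) : k) / (l.factorial : k) * ((-1) ^ j * (l.choose j : k))
  let T : ℕ → ℕ → Composition (n + 1) → A := fun l j c =>
    b (p + c.sizeUpTo j) * pathProd (List.replicate j w ++ List.replicate (l - j) (shift w)) p
      c.blocks
  have hR : bernoulliAd k K w (superdiag b) p (p + (n + 2)) =
      ∑ l ∈ Finset.range K, ∑ j ∈ Finset.range (l + 1), wt l j •
        ∑ c : Composition (n + 1), T l j c := by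
    change entry k p (p + (n + 2)) _ = _
    rw [bernoulliAd, map_sum]
    refine Finset.sum_congr rfl fun l _ => ?_
    rw [map_smul, map_sum, Finset.smul_sum]
    refine Finset.sum_congr rfl fun j _ => ?_
    rw [map_smul, smul_smul]
    congr 1
    have := sum_mul_pathProd b (List.replicate j w) (List.replicate (l - j) (shift w))
      (fun G hG => by rw [List.eq_of_mem_replicate hG]; exact hw0)
      (fun G hG => by rw [List.eq_of_mem_replicate hG]; exact hs0) p (n + 1)
    rw [List.prod_replicate, List.prod_replicate, List.length_replicate, ← shift_pow,
      ← mul_superdiag_mul_apply] at this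
    exact this.symm
  -- In `bernoulliAd` the order l is independent of c, but a path with c.length steps only meets
  -- products of c.length factors. The truncation K > n + 1 includes that order.
  have hL : ∀ c : Composition (n + 1),
      ∑ l ∈ Finset.range K, ∑ j ∈ Finset.range (l + 1), wt l j • T l j c =
      ∑ j ∈ Finset.range (c.length + 1), wt c.length j • T c.length j c := by
    intro c
    refine Finset.sum_eq_single_of_mem c.length
      (Finset.mem_range.2 (lt_of_le_of_lt c.length_le hK)) fun l _ hl => ?_
    refine Finset.sum_eq_zero fun j hj => ?_
    rw [Finset.mem_range] at hj
    simp only [T]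
    rw [pathProd_of_length_ne, mul_zero, smul_zero]
    rw [c.blocks_length, List.length_append, List.length_replicate, List.length_replicate]
    omega
  have hsw : bernoulliAd k K w (superdiag b) p (p + (n + 2)) = ∑ c : Composition (n + 1),
      ∑ j ∈ Finset.range (c.length + 1), wt c.length j • T c.length j c := by
    rw [hR, ← Finset.sum_congr rfl fun c _ => hL c, Finset.sum_comm]
    refine Finset.sum_congr rfl fun l _ => ?_
    rw [Finset.sum_comm]
    exact Finset.sum_congr rfl fun j _ => Finset.smul_sum
  rw [hsw, magnus, map_sum]
  refine Finset.sum_congr rfl fun c _ => ?_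
  rw [Finset.sum_range, map_sum]
  refine Finset.sum_congr rfl fun j _ => ?_
  rw [map_smul, I.prod_magnus_removeNth b p n c j]
  rfl

/-- The integrated Magnus equation for all entries in the columns up to K. It merges the recursion
with its initial case q = p + 1, where only r itself survives, and with q ≤ p, where both sides
vanish. -/
theorem magnusEntries_eq_primitive (b : ℕ → A) (K p q : ℕ) (hq : q ≤ K) :
    I.magnusEntries b p q =
      I.primitive (bernoulliAd k K (I.magnusEntries b) (superdiag b) p q) := by
  have hz : ∀ i j, q < p + (i + j + 1) →
      ((I.magnusEntries b) ^ i * superdiag b * (I.magnusEntries b) ^ j) p q = 0 := fun i j h =>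
    pow_mul_superdiag_mul_pow_apply_eq_zero (I.magnusEntries_self b) b i j p q h
  have hentry : bernoulliAd k K (I.magnusEntries b) (superdiag b) p q =
      ∑ l ∈ Finset.range K, (((_root_.bernoulli l : ℚ) : k) / (l.factorial : k)) •
        ∑ j ∈ Finset.range (l + 1), ((-1 : k) ^ j * (l.choose j : k)) •
          ((I.magnusEntries b) ^ j * superdiag b * (I.magnusEntries b) ^ (l - j)) p q := by
    change entry k p q _ = _
    simp only [bernoulliAd, map_sum, map_smul]
    rfl
  rcases lt_or_ge p q with h | h
  · obtain ⟨m, rfl⟩ : ∃ m, q = p + (m + 1) := ⟨q - p - 1, by omega⟩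
    cases m with
    | zero =>
      -- The term l = 0, absent from the recursion for n ≥ 2, is what yields 𝓜_1.
      rw [hentry, Finset.sum_eq_single_of_mem 0 (Finset.mem_range.2 (by omega))]
      · rw [magnusEntries_apply, I.magnus_congr (w := fun i : Fin 1 => b (p + i)) (by omega)
          fun _ _ _ => rfl, magnus]
        simp [superdiag]
      · intro l _ hl
        rw [Finset.sum_eq_zero fun j hj => ?_, smul_zero]
        rw [Finset.mem_range] at hj
        rw [hz _ _ (by omega), smul_zero]
    | succ m =>
      rw [magnusEntries_apply, ← I.magnus_add_two b p m K (by omega)]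
      exact I.magnus_congr (by omega) fun _ _ _ => rfl
  · rw [hentry, Finset.sum_eq_zero, map_zero]
    · rcases eq_or_lt_of_le h with rfl | h
      · exact I.magnusEntries_self b _
      · exact apply_eq_zero_of_not_le (by omega) _
    · intro l _
      rw [Finset.sum_eq_zero fun j hj => ?_, smul_zero]
      rw [hz _ _ (by omega), smul_zero]

variable {I} in
-- Row 0 of e^w solves E = 1 + P(E r), with P the primitive; this is the recursion that defines the
-- iterated integrals.
theorem sum_pow_magnusEntries
    (hP : ∀ f g, I.primitive f * I.primitive g =
      I.primitive (f * I.primitive g + I.primitive f * g)) (b : ℕ → A) (n : ℕ) :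
    ∑ q ∈ Finset.range (n + 1), (q.factorial : k)⁻¹ • (I.magnusEntries b ^ q) 0 n =
      I.iterated n fun i => b i := by
  induction n with
  | zero => simp [iterated_zero]
  | succ n ih =>
    set w := I.magnusEntries b with hw
    have hw0 : ∀ i, w i i = 0 := I.magnusEntries_self b
    have hfirst : (w ^ 0) 0 (n + 1) = 0 := by simp
    rw [Finset.sum_range_succ' _ (n + 1), hfirst, smul_zero, add_zero, iterated_succ]
    have h := sum_geom_bernoulliAd (entry k 0 (n + 1)) (n + 1) w (superdiag b) fun i j hij =>
      pow_mul_superdiag_mul_pow_apply_eq_zero hw0 b i j 0 (n + 1) (by omega)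
    have h2 : ∀ m, (w ^ (m + 1)) 0 (n + 1) = I.primitive (entry k 0 (n + 1)
        (∑ i ∈ Finset.range (m + 1), w ^ i * bernoulliAd k (n + 1) w (superdiag b) * w ^ (m - i))) :=
      fun m => pow_eq_primitive hP (fun p q hq => I.magnusEntries_eq_primitive b (n + 1) p q hq)
        m 0 (n + 1) le_rfl
    rw [Finset.sum_congr rfl fun m _ => congrArg _ (h2 m)]
    simp only [← map_smul]
    rw [← map_sum, ← map_sum, h]
    congr 1
    have hih : I.iterated n (Fin.init fun i : Fin (n + 1) => b i) = I.iterated n fun i => b i := rfl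
    rw [hih, ← ih, map_sum, Finset.sum_mul]
    refine Finset.sum_congr rfl fun q _ => ?_
    rw [map_smul, Algebra.smul_mul_assoc]
    congr 1
    -- Right multiplication by r appends the last letter, as the outermost integration does.
    exact mul_superdiag_apply b (w ^ q) 0 n

variable {I} in
/-- The exponential of `magnus` is given by the iterated integrals. -/
theorem sum_prod_magnus
    (hP : ∀ f g, I.primitive f * I.primitive g =
      I.primitive (f * I.primitive g + I.primitive f * g)) (n : ℕ) (a : Fin n → A) :
    ∑ c : Composition n, (c.length.factorial : k)⁻¹ •
      ∏ h : Fin c.length, I.magnus (c.blocksFun h) (a ∘ c.embedding h) = I.iterated n a := by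
  -- Matrices are indexed by ℕ; the padding by 0 is harmless, since the entry (0, n) reads only
  -- letters below n.
  let b : ℕ → A := fun i => if h : i < n then a ⟨i, h⟩ else 0
  have hb : (fun i : Fin n => b i) = a := by
    funext i
    simp [b]
  rw [← hb, ← sum_pow_magnusEntries hP b n]
  set w := I.magnusEntries b with hw
  have hpow : ∀ q, (w ^ q) 0 n = ∑ c : Composition n, pathProd (List.replicate q w) 0 c.blocks := by
    intro q
    rw [sum_pathProd _ fun G hG => by rw [List.eq_of_mem_replicate hG]; exact I.magnusEntries_self b,
      List.prod_replicate, zero_add]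
  simp only [hpow, Finset.smul_sum]
  rw [Finset.sum_comm]
  refine Finset.sum_congr rfl fun c _ => ?_
  rw [Finset.sum_eq_single_of_mem c.length
    (Finset.mem_range.2 (Nat.lt_succ_of_le c.length_le)) fun q _ hq => ?_]
  · rw [pathProd_eq_prod _ _ _ (by rw [c.blocks_length, List.length_replicate])]
    congr 1
    refine Finset.prod_congr rfl fun h _ => ?_
    have hsucc : c.sizeUpTo (h + 1) = c.sizeUpTo h + c.blocksFun h := c.sizeUpTo_succ' h
    change _ = (List.getD _ (h : ℕ) 0 : IncidenceAlgebra A ℕ) (0 + c.sizeUpTo h) (0 + c.sizeUpTo (h + 1))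
    rw [hsucc, List.getD_replicate _ h.2, hw, magnusEntries_apply]
    refine I.magnus_congr (by omega) fun i _ _ => ?_
    simp
  · rw [pathProd_of_length_ne, smul_zero]
    rw [c.blocks_length, List.length_replicate]
    exact hq.symm

end IntervalFunctions

/-! ### Reduction of φ_s on one-forms to the exponential of 𝓜 -/

namespace IntervalFunctions

variable {k A : Type*} [Field k] [CommRing A] [Algebra k A] {I : IntervalFunctions k A}

/-- With t the primitive of 1, this is t^n/n!, the volume of a simplex. Integration by parts alone
gives t^{m+1} = (m+1) ∫ t^m. -/
theorem iterated_const_one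
    (hP : ∀ f g, I.primitive f * I.primitive g =
      I.primitive (f * I.primitive g + I.primitive f * g)) [CharZero k] (n : ℕ) :
    I.iterated n (fun _ => 1) = (n.factorial : k)⁻¹ • I.primitive 1 ^ n := by
  have hpow : ∀ m : ℕ, I.primitive 1 ^ (m + 1) = ((m + 1 : ℕ) : k) • I.primitive
      (I.primitive 1 ^ m) := by
    intro m
    induction m with
    | zero => simp
    | succ m ih =>
      have h := hP 1 (((m + 1 : ℕ) : k) • I.primitive 1 ^ m)
      rw [map_smul, ← ih, ← pow_succ', mul_smul_comm, ← pow_succ', one_mul, map_add, map_smul] at h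
      rw [h, Nat.cast_succ (m + 1), add_smul, one_smul, add_comm]
  induction n with
  | zero => simp [iterated_zero]
  | succ n ih =>
    have : I.iterated n (Fin.init fun _ : Fin (n + 1) => (1 : A)) = I.iterated n fun _ => 1 := rfl
    rw [iterated_succ, this, ih, mul_one, map_smul, hpow, smul_smul, Nat.factorial_succ]
    congr 1
    have h1 : ((n + 1 : ℕ) : k) ≠ 0 := Nat.cast_ne_zero.2 n.succ_ne_zero
    rw [Nat.cast_mul]
    field_simp

theorem iterated_scale (s : k) (c : A →ₗ[k] A) (hone : c 1 = 1)
    (hmul : ∀ f g, c (f * g) = c f * c g)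
    (hprim : ∀ f, I.primitive (s • c f) = c (I.primitive f)) (n : ℕ) (a : Fin n → A) :
    I.iterated n (fun i => s • c (a i)) = c (I.iterated n a) := by
  induction n with
  | zero => rw [iterated_zero, iterated_zero, hone]
  | succ n ih =>
    have : I.iterated n (Fin.init fun i => s • c (a i)) = c (I.iterated n (Fin.init a)) :=
      ih (Fin.init a)
    rw [iterated_succ, iterated_succ, this, mul_smul_comm, ← hmul, hprim]

theorem gugenheim_oneForm (hsimplex : ∀ n a, I.simplexIntegral n a = I.evalOne (I.iterated n a))
    (n : ℕ) (hn : 1 ≤ n) (a : Fin n → A) :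
    I.gugenheim n (fun i => oneForm (a i)) = I.evalOne (I.iterated n a) • dt k := by
  match n, hn with
  | 1, _ =>
    have h : I.iterated 1 a = I.primitive (a 0) := by
      rw [iterated_succ, iterated_zero, one_mul]; rfl
    rw [h]
    change I.proj (oneForm (a 0)) = _
    simp [proj, oneForm, dt]
  | n + 2, _ =>
    rw [← hsimplex]
    rfl

theorem gugenheim_comp_strict_zero (f : Forms A →ₗ[k] Forms A) :
    I.gugenheim.comp (TaylorMaps.strict f) 0 = 0 := by
  refine MultilinearMap.ext fun v => ?_
  rw [TaylorMaps.comp_apply]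
  refine Finset.sum_eq_zero fun d _ => ?_
  rw [TaylorMaps.congr_coeff I.gugenheim (w := Fin.elim0) (Nat.le_zero.1 d.length_le)
    (fun i _ hi => absurd hi (Nat.not_lt_zero i))]
  rfl

theorem comp_strict_apply {U V W : Type*} [AddCommGroup U] [Module k U] [AddCommGroup V]
    [Module k V] [AddCommGroup W] [Module k W] (g : TaylorMaps k V W) (f : U →ₗ[k] V) (n : ℕ)
    (v : Fin n → U) : g.comp (TaylorMaps.strict f) n v = g n fun i => f (v i) := by
  rw [TaylorMaps.comp_apply, Fintype.sum_eq_single (Composition.ones n)]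
  · rw [TaylorMaps.applyBlocks_ones]
    exact TaylorMaps.congr_coeff g (Composition.ones_length n) fun i _ _ => rfl
  · intro c hc
    obtain ⟨l, hl, hl1⟩ := Composition.ne_ones_iff.1 hc
    obtain ⟨i, hi⟩ := List.get_of_mem hl
    refine MultilinearMap.map_coord_zero _ (Fin.cast c.blocks_length i) ?_
    have : ∀ (m : ℕ) (u : Fin m → U), 1 < m → TaylorMaps.strict f m u = 0 := by
      intro m u hm
      match m, hm with
      | _ + 2, _ => rfl
    refine this _ _ ?_
    change 1 < c.blocks.get i
    omega

variable [CharZero k]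

/-- Each summand of a higher coefficient contains a factor `tCoeff`, which kills dt. So the
Bernoulli polynomials in μ play no role on one-forms. -/
theorem transfer_smul_dt {n : ℕ} (hn : n ≠ 1) (x : Fin n → k) :
    I.transfer n (fun i => x i • dt k) = 0 := by
  match n, hn with
  | 0, _ => rfl
  | n + 2, _ =>
    simp only [transfer, LinearMap.compMultilinearMap_apply, _root_.sum_apply,
      _root_.smul_apply, MultilinearMap.compLinearMap_apply]
    rw [Finset.sum_eq_zero, map_zero]
    intro i _
    rw [MultilinearMap.mkPiAlgebra_apply, Finset.prod_eq_zero (Finset.mem_univ i), smul_zero]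
    simp [tCoeff, dt]

theorem transfer_one_smul_dt (x : Fin 1 → k) :
    I.transfer 1 (fun i => x i • dt k) = oneForm (x 0 • I.ofPoly 1) := by
  change I.incl (x 0 • dt k) = _
  simp [incl, dt, oneForm]

theorem exp_smul_dt
    (hP : ∀ f g, I.primitive f * I.primitive g =
      I.primitive (f * I.primitive g + I.primitive f * g))
    (hsimplex : ∀ n a, I.simplexIntegral n a = I.evalOne (I.iterated n a))
    (hpoly : I.ofPoly 1 = 1) (hev : ∀ n : ℕ, I.evalOne (I.primitive 1 ^ n) = 1)
    (n : ℕ) (hn : 1 ≤ n) (x : Fin n → k) :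
    I.exp n (fun i => x i • dt k) = ((n.factorial : k)⁻¹ * ∏ i, x i) • dt k := by
  rw [exp, TaylorMaps.comp_apply, Fintype.sum_eq_single (Composition.ones n)]
  · rw [TaylorMaps.applyBlocks_ones]
    have h1 : ∀ i : Fin n, I.transfer 1 (fun _ => x i • dt k) = oneForm (x i • (1 : A)) := by
      intro i
      rw [← hpoly]
      exact I.transfer_one_smul_dt fun _ => x i
    rw [TaylorMaps.congr_coeff I.gugenheim (w := fun i : Fin n => oneForm (x i • (1 : A)))
      (Composition.ones_length n) fun i _ hi => h1 ⟨i, hi⟩, gugenheim_oneForm hsimplex n hn,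
      MultilinearMap.map_smul_univ, iterated_const_one hP, map_smul, map_smul, hev, smul_eq_mul,
      smul_eq_mul, mul_one, mul_comm]
  · intro c hc
    obtain ⟨l, hl, hl1⟩ := Composition.ne_ones_iff.1 hc
    obtain ⟨i, hi⟩ := List.get_of_mem hl
    refine MultilinearMap.map_coord_zero _ (Fin.cast c.blocks_length i) ?_
    refine I.transfer_smul_dt ?_ _
    change c.blocks.get i ≠ 1
    omega

/-- Characterises φ_s by an equation in which `log` no longer occurs. -/
theorem exp_comp_phiScaled (hproj : I.proj ∘ₗ I.incl = LinearMap.id) (s : k) (c : A →ₗ[k] A) :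
    I.exp.comp (I.phiScaled s c) = I.gugenheim.comp (TaylorMaps.strict (pullback s c)) := by
  rw [phiScaled, phi, TaylorMaps.comp_assoc, ← TaylorMaps.comp_assoc, (I.log_exp_inverse hproj).2,
    TaylorMaps.one_comp _ (gugenheim_comp_strict_zero _)]

/-- Evaluation at s is the algebra homomorphism ev ∘ c, so `sum_prod_magnus` becomes an identity of
scalars. It is compared with exp ∘ φ_s = λ ∘ β_s^*, composition by composition: with two or more
blocks the terms agree by induction, and the single block gives the claim. -/
theorem phiScaled_oneForm (hproj : I.proj ∘ₗ I.incl = LinearMap.id)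
    (hP : ∀ f g, I.primitive f * I.primitive g =
      I.primitive (f * I.primitive g + I.primitive f * g))
    (hsimplex : ∀ n a, I.simplexIntegral n a = I.evalOne (I.iterated n a))
    (hpoly : I.ofPoly 1 = 1) (ev : A →ₐ[k] k) (hev : ∀ f, ev f = I.evalOne f)
    (hprimOne : I.evalOne (I.primitive 1) = 1)
    (s : k) (c : A →ₐ[k] A) (hprim : ∀ f, I.primitive (s • c f) = c (I.primitive f))
    (n : ℕ) (hn : 1 ≤ n) (a : Fin n → A) :
    I.phiScaled s c.toLinearMap n (fun i => oneForm (a i)) = ev (c (I.magnus n a)) • dt k := by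
  have hpow : ∀ n : ℕ, I.evalOne (I.primitive 1 ^ n) = 1 := fun n => by
    rw [← hev, map_pow, hev, hprimOne, one_pow]
  induction n using Nat.strong_induction_on with
  | _ n ih =>
    have hexp := congrArg (fun F => F n fun i => oneForm (a i))
      (I.exp_comp_phiScaled hproj s c.toLinearMap)
    have hpull : ∀ f : A, pullback s c.toLinearMap (oneForm f) = oneForm (s • c f) := fun f => by
      simp [pullback, oneForm]
    have hsc : I.iterated n (fun i => s • c (a i)) = c (I.iterated n a) :=
      iterated_scale s c.toLinearMap (map_one c) (map_mul c) hprim n a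
    simp only [comp_strict_apply, hpull] at hexp
    rw [gugenheim_oneForm hsimplex n hn, hsc, ← hev, ← sum_prod_magnus hP n a,
      TaylorMaps.comp_apply, map_sum, map_sum, Finset.sum_smul,
      ← Finset.add_sum_erase _ _ (Finset.mem_univ (Composition.single n hn)),
      ← Finset.add_sum_erase _ _ (Finset.mem_univ (Composition.single n hn))] at hexp
    have hrest : ∀ d ∈ Finset.univ.erase (Composition.single n hn),
        I.exp d.length ((I.phiScaled s c.toLinearMap).applyBlocks d fun i => oneForm (a i)) =
        ev (c ((d.length.factorial : k)⁻¹ •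
          ∏ h : Fin d.length, I.magnus (d.blocksFun h) (a ∘ d.embedding h))) • dt k := by
      intro d hd
      have hlt : ∀ h, d.blocksFun h < n :=
        (Composition.ne_single_iff hn).1 (Finset.ne_of_mem_erase hd)
      have : ((I.phiScaled s c.toLinearMap).applyBlocks d fun i => oneForm (a i)) =
          fun h => ev (c (I.magnus (d.blocksFun h) (a ∘ d.embedding h))) • dt k :=
        funext fun h => ih _ (hlt h) (d.one_le_blocksFun h) _
      rw [this, exp_smul_dt hP hsimplex hpoly hpow _ (d.length_pos_of_pos hn), map_smul, map_smul,
        map_prod, map_prod, smul_eq_mul]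
    rw [Finset.sum_congr rfl hrest] at hexp
    have hlast := add_right_cancel hexp
    -- The value of φ_{s,n} is not yet known to be a multiple of dt, so `exp_smul_dt` is
    -- unavailable; the linear part of exp being the identity suffices.
    have hl : I.exp (Composition.single n hn).length
        ((I.phiScaled s c.toLinearMap).applyBlocks (Composition.single n hn)
          fun i => oneForm (a i)) = I.phiScaled s c.toLinearMap n fun i => oneForm (a i) := by
      rw [TaylorMaps.congr_coeff I.exp (w := fun _ : Fin 1 =>
        I.phiScaled s c.toLinearMap n fun i => oneForm (a i)) (Composition.single_length hn)
        fun i h1 _ => ?_, I.exp_linear_part hproj]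
      · rfl
      · refine TaylorMaps.congr_coeff _ (Composition.single_blocksFun hn _) fun j _ _ => ?_
        refine congrArg (fun x => oneForm (a x)) (Fin.ext ?_)
        rw [Composition.coe_embedding]
        have : i = 0 := by rw [Composition.single_length] at h1; omega
        simp [this]
    have hr : ((Composition.single n hn).length.factorial : k)⁻¹ •
        ∏ h : Fin (Composition.single n hn).length,
          I.magnus ((Composition.single n hn).blocksFun h)
            (a ∘ (Composition.single n hn).embedding h) = I.magnus n a := by
      have hfac : ((Composition.single n hn).length.factorial : k)⁻¹ = 1 := by
        rw [Composition.single_length, Nat.factorial_one, Nat.cast_one, inv_one]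
      rw [hfac, one_smul]
      refine (Fin.prod_univ_one (M := A) _).trans ?_
      refine I.magnus_congr (Composition.single_blocksFun hn _) fun j _ _ => ?_
      refine congrArg a (Fin.ext ?_)
      refine ((Composition.single n hn).coe_embedding _ _).trans ?_
      change (Composition.single n hn).sizeUpTo 0 + j = j
      rw [Composition.sizeUpTo_zero, zero_add]
    rw [hl, hr] at hlast
    exact hlast

end IntervalFunctions

/-! ### Polynomial forms satisfy the assumptions -/

section Poly

variable {k : Type*} [Field k]

theorem polynomialPrimitive_monomial (m : ℕ) (a : k) :
    polynomialPrimitive k (monomial m a) = monomial (m + 1) (a * (m + 1 : k)⁻¹) := by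
  have h := (Polynomial.basisMonomials k).constr_basis k
    (fun m => monomial (m + 1) ((m + 1 : k)⁻¹)) m
  rw [Polynomial.coe_basisMonomials] at h
  rw [← mul_one a, ← smul_eq_mul, ← smul_monomial, map_smul, polynomialPrimitive]
  refine (congrArg _ h).trans ?_
  rw [smul_monomial, smul_eq_mul, smul_eq_mul, mul_one]

theorem coeff_zero_polynomialPrimitive (f : k[X]) : (polynomialPrimitive k f).coeff 0 = 0 := by
  induction f using Polynomial.induction_on' with
  | add p q hp hq => rw [map_add, coeff_add, hp, hq, add_zero]
  | monomial m a => rw [polynomialPrimitive_monomial, coeff_monomial, if_neg (by omega)]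

/-- Integrating from the innermost variable outwards, the degree after each integration is a partial
sum of the m_i + 1, and this degree is also the new denominator. -/
theorem poly_iterated_monomial (n : ℕ) (m : Fin n → ℕ) :
    (polyIntervalFunctions k).iterated n (fun i => monomial (m i) 1) =
      monomial (∑ i, (m i + 1)) (∏ j : Fin n, ∑ i ∈ Finset.Iic j, ((m i : k) + 1))⁻¹ := by
  induction n with
  | zero => simp [IntervalFunctions.iterated_zero]
  | succ n ih =>
    have h := ih fun i => m i.castSucc
    have hI : ∀ j : Fin n, ∑ i ∈ Finset.Iic j.castSucc, ((m i : k) + 1) =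
        ∑ i ∈ Finset.Iic j, ((m i.castSucc : k) + 1) := fun j => by
      rw [← Fin.map_castSuccEmb_Iic, Finset.sum_map]
      rfl
    have hlast : ∑ i ∈ Finset.Iic (Fin.last n), ((m i : k) + 1) =
        ((∑ i : Fin n, (m i.castSucc + 1) + m (Fin.last n) : ℕ) : k) + 1 := by
      have htop : Finset.Iic (Fin.last n) = Finset.univ := Finset.Iic_top
      rw [htop, Fin.sum_univ_castSucc]
      push_cast
      ring
    rw [IntervalFunctions.iterated_succ]
    change polynomialPrimitive k ((polyIntervalFunctions k).iterated n
      (fun i => monomial (m i.castSucc) 1) * monomial (m (Fin.last n)) 1) = _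
    rw [h, monomial_mul_monomial, polynomialPrimitive_monomial, Fin.prod_univ_castSucc,
      Fin.sum_univ_castSucc, Finset.prod_congr rfl fun j _ => hI j, hlast, mul_inv, mul_one]
    rfl

theorem mvPolynomialSimplexIntegral_monomial (n : ℕ) (m : Fin n → ℕ) :
    mvPolynomialSimplexIntegral k n (∏ i, MvPolynomial.X i ^ m i) =
      (∏ j : Fin n, ∑ i ∈ Finset.Iic j, ((m i : k) + 1))⁻¹ := by
  have h := (MvPolynomial.basisMonomials (Fin n) k).constr_basis k
    (fun m => (∏ j : Fin n, ∑ i ∈ Finset.Iic j, ((m i : k) + 1))⁻¹)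
    (Finsupp.equivFunOnFinite.symm m)
  rw [MvPolynomial.coe_basisMonomials] at h
  beta_reduce at h
  rw [MvPolynomial.monomial_eq, MvPolynomial.C_1, one_mul,
    Finsupp.prod_fintype _ _ fun _ => pow_zero _] at h
  exact h

theorem poly_simplexIntegral (n : ℕ) (a : Fin n → k[X]) :
    (polyIntervalFunctions k).simplexIntegral n a =
      (polyIntervalFunctions k).evalOne ((polyIntervalFunctions k).iterated n a) := by
  have h : (polyIntervalFunctions k).simplexIntegral n =
      (polyIntervalFunctions k).evalOne.compMultilinearMap
        ((polyIntervalFunctions k).iterated n) := by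
    refine Module.Basis.ext_multilinear (fun _ => Polynomial.basisMonomials k) fun m => ?_
    rw [LinearMap.compMultilinearMap_apply, Polynomial.coe_basisMonomials, poly_iterated_monomial]
    change mvPolynomialSimplexIntegral k n (∏ i, aeval (MvPolynomial.X i) (monomial (m i) 1)) =
      eval 1 _
    simp only [aeval_monomial, map_one, one_mul]
    rw [mvPolynomialSimplexIntegral_monomial, eval_monomial, one_pow, mul_one]
  rw [h]
  rfl

variable [CharZero k]

theorem derivative_polynomialPrimitive (f : k[X]) :
    derivative (polynomialPrimitive k f) = f := by
  induction f using Polynomial.induction_on' with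
  | add p q hp hq => rw [map_add, map_add, hp, hq]
  | monomial m a =>
    rw [polynomialPrimitive_monomial, derivative_monomial, Nat.cast_succ, mul_assoc,
      inv_mul_cancel₀ (Nat.cast_add_one_ne_zero m), mul_one, Nat.add_sub_cancel]

/-- In characteristic zero a polynomial is determined by its derivative and constant term.
Integration by parts and substitution thus reduce to the product and chain rules. -/
theorem eq_polynomialPrimitive {p f : k[X]} (h0 : p.coeff 0 = 0) (hp : derivative p = f) :
    p = polynomialPrimitive k f := by
  rw [← sub_eq_zero]
  have hd : derivative (p - polynomialPrimitive k f) = 0 := by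
    rw [derivative_sub, hp, derivative_polynomialPrimitive, sub_self]
  rw [eq_C_of_natDegree_eq_zero (derivative_eq_zero.1 hd), coeff_sub, h0,
    coeff_zero_polynomialPrimitive, sub_self, C_0]

theorem polynomialPrimitive_mul (f g : k[X]) :
    polynomialPrimitive k f * polynomialPrimitive k g =
      polynomialPrimitive k (f * polynomialPrimitive k g + polynomialPrimitive k f * g) := by
  refine eq_polynomialPrimitive ?_ ?_
  · rw [mul_coeff_zero, coeff_zero_polynomialPrimitive, zero_mul]
  · rw [derivative_mul, derivative_polynomialPrimitive, derivative_polynomialPrimitive]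

theorem polynomialPrimitive_scale (s : k) (f : k[X]) :
    polynomialPrimitive k (s • aeval (C s * X : k[X]) f) =
      aeval (C s * X : k[X]) (polynomialPrimitive k f) := by
  have hc : ∀ p : k[X], aeval (C s * X : k[X]) p = p.comp (C s * X) := fun _ => rfl
  refine (eq_polynomialPrimitive ?_ ?_).symm
  · rw [hc, coeff_zero_eq_eval_zero, eval_comp, eval_mul, eval_X, mul_zero,
      ← coeff_zero_eq_eval_zero, coeff_zero_polynomialPrimitive]
  · rw [hc, hc, derivative_comp, derivative_polynomialPrimitive, derivative_C_mul, derivative_X,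
      mul_one, smul_eq_C_mul]

theorem polyPhi_oneForm (s : k) (n : ℕ) (hn : 1 ≤ n) (a : Fin n → k[X]) :
    polyPhi s n (fun i => oneForm (a i)) =
      ((polyIntervalFunctions k).magnus n a).eval s • dt k := by
  have h1 : polynomialPrimitive k 1 = X := by
    rw [← monomial_zero_one, polynomialPrimitive_monomial]
    simp [monomial_one_one_eq_X]
  have h := IntervalFunctions.phiScaled_oneForm (poly_proj_incl k) polynomialPrimitive_mul
    poly_simplexIntegral rfl (aeval (1 : k)) (fun f => by
      rw [coe_aeval_eq_eval]; rfl) (by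
      change eval 1 (polynomialPrimitive k 1) = 1
      rw [h1, eval_X]) s (aeval (C s * X : k[X])) (polynomialPrimitive_scale s) n hn a
  have he : ∀ p : k[X], aeval (1 : k) (aeval (C s * X : k[X]) p) = p.eval s := fun p => by
    change aeval (1 : k) (p.comp (C s * X)) = _
    rw [coe_aeval_eq_eval, eval_comp]
    simp
  rw [he] at h
  exact h

end Poly

/-! ### Smooth forms satisfy the assumptions -/

namespace SmoothFun

theorem extend_mul (f g : SmoothFun) (x : ℝ) : extend (f * g) x = extend f x * extend g x := rfl

theorem extend_add (f g : SmoothFun) (x : ℝ) : extend (f + g) x = extend f x + extend g x := rfl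

theorem extend_primitive (f : SmoothFun) {x : ℝ} (hx : x ∈ Icc (0 : ℝ) 1) :
    extend (primitive f) x = ∫ t in (0 : ℝ)..x, extend f t :=
  extend_of_mem _ hx

theorem ext_extend {f g : SmoothFun} (h : ∀ x ∈ Icc (0 : ℝ) 1, extend f x = extend g x) :
    f = g := by
  refine Subtype.ext (funext fun x => ?_)
  have := h x x.2
  rwa [extend_of_mem f x.2, extend_of_mem g x.2] at this

theorem primitive_mul (f g : SmoothFun) :
    primitive f * primitive g = primitive (f * primitive g + primitive f * g) := by
  refine ext_extend fun x hx => ?_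
  have hd : ∀ (h : SmoothFun) (y : ℝ),
      HasDerivAt (fun x => ∫ t in (0 : ℝ)..x, extend h t) (extend h y) y := fun h y =>
    ((continuous_extend h).integral_hasStrictDerivAt 0 y).hasDerivAt
  have h := intervalIntegral.integral_deriv_mul_eq_sub (a := 0) (b := x) (fun y _ => hd f y)
    (fun y _ => hd g y) ((continuous_extend f).intervalIntegrable _ _)
    ((continuous_extend g).intervalIntegrable _ _)
  rw [intervalIntegral.integral_same, zero_mul, sub_zero] at h
  rw [extend_mul, extend_primitive f hx, extend_primitive g hx, extend_primitive _ hx, ← h]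
  refine intervalIntegral.integral_congr fun y hy => ?_
  rw [uIcc_of_le hx.1] at hy
  have hy' : y ∈ Icc (0 : ℝ) 1 := ⟨hy.1, hy.2.trans hx.2⟩
  simp only [extend_add, extend_mul, extend_primitive f hy', extend_primitive g hy']

theorem extend_scale (s : Icc (0 : ℝ) 1) (f : SmoothFun) {x : ℝ} (hx : x ∈ Icc (0 : ℝ) 1) :
    extend (scale s f) x = extend f (s * x) := by
  rw [extend_of_mem _ hx]
  exact (extend_of_mem f (s * ⟨x, hx⟩ : Icc (0 : ℝ) 1).2).symm

theorem primitive_scale (s : Icc (0 : ℝ) 1) (f : SmoothFun) :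
    primitive ((s : ℝ) • scale s f) = scale s (primitive f) := by
  refine ext_extend fun x hx => ?_
  have hsx : (s : ℝ) * x ∈ Icc (0 : ℝ) 1 := (s * ⟨x, hx⟩ : Icc (0 : ℝ) 1).2
  rw [extend_scale s _ hx, extend_primitive _ hsx, map_smul]
  change (s : ℝ) * extend (primitive (scale s f)) x = _
  have h := intervalIntegral.smul_integral_comp_mul_left (a := 0) (b := x) (extend f) (s : ℝ)
  rw [mul_zero, smul_eq_mul] at h
  rw [extend_primitive _ hx, ← h]
  congr 1
  refine intervalIntegral.integral_congr fun y hy => ?_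
  rw [uIcc_of_le hx.1] at hy
  exact extend_scale s f ⟨hy.1, hy.2.trans hx.2⟩

/-- Fibres the simplex cut off at u over its largest coordinate; the fibre is a simplex cut off at
that coordinate. -/
theorem mem_simplex_succ_iff {n : ℕ} {u : ℝ} (hu : u ≤ 1) (t : Fin (n + 1) → ℝ) :
    t ∈ simplex (n + 1) ∩ {v | ∀ i, v i ≤ u} ↔
      t (Fin.last n) ∈ Icc 0 u ∧ (fun i : Fin n => t i.castSucc) ∈ simplex n ∧
        ∀ i : Fin n, t i.castSucc ≤ t (Fin.last n) := by
  constructor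
  · rintro ⟨⟨h1, h2⟩, h3⟩
    exact ⟨⟨(h1 _).1, h3 _⟩, ⟨fun i => h1 _, fun i j hij => h2 (Fin.castSucc_le_castSucc_iff.2 hij)⟩,
      fun i => h2 (Fin.le_last _)⟩
  · rintro ⟨h1, ⟨h2, h3⟩, h4⟩
    refine ⟨⟨fun i => ?_, fun i j hij => ?_⟩, fun i => ?_⟩
    · induction i using Fin.lastCases with
      | last => exact ⟨h1.1, h1.2.trans hu⟩
      | cast i => exact h2 i
    · induction j using Fin.lastCases with
      | last =>
        induction i using Fin.lastCases with
        | last => exact le_rfl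
        | cast i => exact h4 i
      | cast j =>
        induction i using Fin.lastCases with
        | last => exact absurd hij (not_le.2 (Fin.castSucc_lt_last j))
        | cast i => exact h3 (Fin.castSucc_le_castSucc_iff.1 hij)
    · induction i using Fin.lastCases with
      | last => exact h1.2
      | cast i => exact (h4 i).trans h1.2

theorem integral_simplex_succ {n : ℕ} {u : ℝ} (hu : u ∈ Icc (0 : ℝ) 1) (f : (Fin n → ℝ) → ℝ)
    (g : ℝ → ℝ) (hf : Continuous f) (hg : Continuous g) :
    ∫ t in simplex (n + 1) ∩ {v | ∀ i, v i ≤ u},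
        f (fun i => t i.castSucc) * g (t (Fin.last n)) =
      ∫ x in (0 : ℝ)..u, (∫ v in simplex n ∩ {v | ∀ i, v i ≤ x}, f v) * g x := by
  let T : Set (ℝ × (Fin n → ℝ)) := (Icc 0 u ×ˢ simplex n) ∩ {p | ∀ i, p.2 i ≤ p.1}
  -- Compactness supplies both the measurability and the integrability needed for Fubini.
  have hTc : IsCompact T := (isCompact_Icc.prod (isCompact_simplex n)).inter_right <| by
    simp only [ofPred_forall]
    exact isClosed_iInter fun i =>
      isClosed_le ((continuous_apply i).comp continuous_snd) continuous_fst
  let F : ℝ × (Fin n → ℝ) → ℝ := fun p => f p.2 * g p.1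
  have hF : Continuous F := (hf.comp continuous_snd).mul (hg.comp continuous_fst)
  let e := MeasurableEquiv.piFinSuccAbove (fun _ : Fin (n + 1) => ℝ) (Fin.last n)
  have hemp : MeasurePreserving e volume volume :=
    volume_preserving_piFinSuccAbove (fun _ : Fin (n + 1) => ℝ) (Fin.last n)
  have he : ∀ t, e t = (t (Fin.last n), fun i => t i.castSucc) := fun t => by
    refine Prod.ext rfl (funext fun i => ?_)
    change t ((Fin.last n).succAbove i) = _
    rw [Fin.succAbove_last]
  have hpre : simplex (n + 1) ∩ {v | ∀ i, v i ≤ u} = e ⁻¹' T := by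
    ext t
    rw [mem_simplex_succ_iff hu.2, mem_preimage, he, and_assoc.symm]
    rfl
  have hint : ∀ t : Fin (n + 1) → ℝ, f (fun i => t i.castSucc) * g (t (Fin.last n)) = F (e t) :=
    fun t => by rw [he]
  rw [hpre, setIntegral_congr_fun (e.measurable hTc.measurableSet) fun t _ => hint t,
    hemp.setIntegral_preimage_emb e.measurableEmbedding F T, ← integral_indicator hTc.measurableSet]
  have hInt : Integrable (T.indicator F) (volume.prod volume) :=
    (hF.continuousOn.integrableOn_compact hTc).integrable_indicator hTc.measurableSet
  have hprod : (volume : Measure (ℝ × (Fin n → ℝ))) = volume.prod volume := rfl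
  rw [hprod, integral_prod _ hInt, intervalIntegral.integral_of_le hu.1,
    ← integral_Icc_eq_integral_Ioc, ← integral_indicator measurableSet_Icc]
  refine integral_congr_ae (Filter.Eventually.of_forall fun x => ?_)
  have hmeas : MeasurableSet (simplex n ∩ {v | ∀ i, v i ≤ x}) := by
    refine (isCompact_simplex n).measurableSet.inter ?_
    simp only [ofPred_forall]
    exact (isClosed_iInter fun i => isClosed_le (continuous_apply i) continuous_const).measurableSet
  by_cases hx : x ∈ Icc 0 u
  · simp only [indicator_of_mem hx]
    rw [← integral_mul_const, ← integral_indicator hmeas]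
    refine integral_congr_ae (Filter.Eventually.of_forall fun v => ?_)
    have hiff : (x, v) ∈ T ↔ v ∈ simplex n ∩ {v | ∀ i, v i ≤ x} := by
      simp only [T, mem_inter_iff, mem_prod, hx, true_and, mem_ofPred_eq]
    by_cases hv : v ∈ simplex n ∩ {v | ∀ i, v i ≤ x}
    · simp only [indicator_of_mem (hiff.2 hv), indicator_of_mem hv, F]
    · simp only [indicator_of_notMem (fun h => hv (hiff.1 h)), indicator_of_notMem hv]
  · simp only [indicator_of_notMem hx]
    have hz : ∀ v, T.indicator F (x, v) = 0 := fun v => indicator_of_notMem (fun h => hx h.1.1) _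
    simp only [hz, integral_zero]

/-- A variable upper bound u is needed for the induction: the inner integral is evaluated at every x
≤ u. The case of interest is u = 1. -/
theorem integral_simplex_eq_iterated (n : ℕ) (a : Fin n → SmoothFun) {u : ℝ}
    (hu : u ∈ Icc (0 : ℝ) 1) :
    ∫ t in simplex n ∩ {v | ∀ i, v i ≤ u}, ∏ i, extend (a i) (t i) =
      extend (smoothIntervalFunctions.iterated n a) u := by
  induction n generalizing u with
  | zero =>
    have huniv : simplex 0 ∩ {v | ∀ i, v i ≤ u} = Set.univ :=
      eq_univ_of_forall fun t => ⟨⟨fun i => i.elim0, fun i => i.elim0⟩, fun i => i.elim0⟩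
    rw [huniv, Measure.restrict_univ, IntervalFunctions.iterated_zero, extend_of_mem _ hu]
    -- The space of empty tuples is a point of mass 1, so the integral of the empty product is 1.
    rw [volume_pi, Measure.pi_of_empty (fun _ : Fin 0 => (volume : Measure ℝ)) 0]
    simp
  | succ n ih =>
    simp only [Fin.prod_univ_castSucc]
    rw [integral_simplex_succ hu (fun v => ∏ i : Fin n, extend (a i.castSucc) (v i))
      (extend (a (Fin.last n)))
      (continuous_finsetProd _ fun i _ => (continuous_extend _).comp (continuous_apply i))
      (continuous_extend _), IntervalFunctions.iterated_succ]
    refine Eq.trans ?_ (extend_primitive _ hu).symm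
    refine intervalIntegral.integral_congr fun x hx => ?_
    rw [uIcc_of_le hu.1] at hx
    simp only [extend_mul]
    rw [ih (fun i => a i.castSucc) ⟨hx.1, hx.2.trans hu.2⟩]
    rfl

theorem simplexIntegral_eq_iterated (n : ℕ) (a : Fin n → SmoothFun) :
    smoothIntervalFunctions.simplexIntegral n a =
      smoothIntervalFunctions.evalOne (smoothIntervalFunctions.iterated n a) := by
  have h := integral_simplex_eq_iterated n a (u := 1) ⟨zero_le_one, le_rfl⟩
  have hs : simplex n ∩ {v | ∀ i, v i ≤ 1} = simplex n :=
    inter_eq_left.2 fun t ht i => (ht.1 i).2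
  rw [hs, extend_of_mem _ ⟨zero_le_one, le_rfl⟩] at h
  exact h

/-- `f(t) ↦ f(s t)`, as a homomorphism of algebras. -/
def scaleHom (s : Icc (0 : ℝ) 1) : SmoothFun →ₐ[ℝ] SmoothFun :=
  AlgHom.ofLinearMap (scale s) rfl fun _ _ => rfl

/-- `f ↦ f(1)`, as a homomorphism of algebras. -/
def evalOneHom : SmoothFun →ₐ[ℝ] ℝ :=
  (Pi.evalAlgHom ℝ (fun _ : Icc (0 : ℝ) 1 => ℝ) 1).comp SmoothFun.val

theorem evalOne_primitive_one :
    smoothIntervalFunctions.evalOne (smoothIntervalFunctions.primitive 1) = 1 := by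
  have h : extend (1 : SmoothFun) = fun _ => 1 := rfl
  change ∫ t in (0 : ℝ)..((1 : Icc (0 : ℝ) 1) : ℝ), extend (1 : SmoothFun) t = 1
  rw [h]
  simp

end SmoothFun

theorem smoothPhi_oneForm (s : Icc (0 : ℝ) 1) (n : ℕ) (hn : 1 ≤ n) (a : Fin n → SmoothFun) :
    smoothPhi s n (fun i => oneForm (a i)) =
      (smoothIntervalFunctions.magnus n a : Icc (0 : ℝ) 1 → ℝ) s • dt ℝ := by
  have hpoly : smoothIntervalFunctions.ofPoly 1 = 1 := by
    refine Subtype.ext (funext fun x => ?_)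
    exact Polynomial.eval_one
  have h := IntervalFunctions.phiScaled_oneForm smooth_proj_incl SmoothFun.primitive_mul
    SmoothFun.simplexIntegral_eq_iterated hpoly SmoothFun.evalOneHom (fun _ => rfl)
    SmoothFun.evalOne_primitive_one (s : ℝ) (SmoothFun.scaleHom s)
    (SmoothFun.primitive_scale s) n hn a
  have he : ∀ f : SmoothFun, SmoothFun.evalOneHom (SmoothFun.scaleHom s f) =
      (f : Icc (0 : ℝ) 1 → ℝ) s := fun f => by
    change (f : Icc (0 : ℝ) 1 → ℝ) (s * 1) = _
    rw [mul_one]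
  rw [he] at h
  exact h

end

theorem mainTheorem6 :
    (∀ (k : Type u) [Field k] [CharZero k] (s : k) (n : ℕ), 1 ≤ n → ∀ a : Fin n → k[X],
      polyPhi s n (fun i => oneForm (a i)) =
        ((polyIntervalFunctions k).magnus n a).eval s • dt k) ∧
    (∀ (s : Icc (0 : ℝ) 1) (n : ℕ), 1 ≤ n → ∀ a : Fin n → SmoothFun,
      smoothPhi s n (fun i => oneForm (a i)) =
        (smoothIntervalFunctions.magnus n a : Icc (0 : ℝ) 1 → ℝ) s • dt ℝ) := by
  exact ⟨fun k _ _ s n hn a => polyPhi_oneForm s n hn a, fun s n hn a => smoothPhi_oneForm s n hn a⟩
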